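/- **Setting.** Systems are finite-dimensional $C^*$-algebras $\bigoplus_j M_{m_j}(\mathbb C)$, processes are completely positive trace preserving maps (channels), $I=\mathbb C$, and $I\oplus I$ is a classical bit. Let $K\ge 1$ and $N\ge 1$, let $n_1,\dots,n_K\ge 1$ with $\prod_i n_i\ge 2$, and let $\phi$ be a density operator on $\bigotimes_{i=1}^K\mathbb C^{n_i}$ (the target state). There are $K$ clients and one source. *Resources and protocols.* A resource is a channel $\bigl(\bigotimes_i A_i\bigr)\otimes A_S\to\bigl(\bigotimes_i B_i\bigr)\otimes B_S$, where client $i$ holds $A_i,B_i$ and the source holds $A_S,B_S$. A protocol $\pi$ on a finite list of resources fixes an order in which some of them are called, each at most once, and gives every party a comb: a sequence of local channels with memory, one before, between and after these calls. Filling the calls with the resources $\bar a$ yields a process $\pi(\bar a)$. $\mathcal A(\pi)$ is the set of protocols obtained from $\pi$ by replacing the source's comb by an arbitrary comb (whose outer input and output systems may be different) while the order of calls and the clients' combs are kept. For two processes of the same type, $d(\Phi,\Psi)=\tfrac12\|\Phi-\Psi\|_\diamond$. *Ideal resource.* $\mathcal S_\phi$ takes a bit $c$ from the source; all clients obtain their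 shares of $\phi$ if $c=0$, and all clients obtain the abort signal $I$ if $c=1$. (The output algebra $(\bigotimes_i M_{n_i}(\mathbb C))\oplus I$ is regarded as a direct summand of $\bigotimes_i(M_{n_i}(\mathbb C)\oplus I)$.) $\sharp_S(\mathcal S_\phi)$ is the resource in which the source's input is fixed to $c=0$. $\mathcal A(\mathrm{id}_{\mathcal S_\phi})$ consists of the attacks on the identity protocol on $\mathcal S_\phi$. *Real resources.* $\bar a=(\mathcal T^{\times(N+1)},\mathcal W)$: $\mathcal T$ delivers a state of $\bigotimes_i M_{n_i}(\mathbb C)$ from the source to the clients, client $i$ receiving the $i$-th share, and lets the clients communicate by some fixed channel among them; $\mathcal W$ is some fixed channel among the clients. *Simple protocols.* Let $\eta$ be a probability distribution on $N+1$ registers and $\mu:\bigl(\bigotimes_i M_{n_i}(\mathbb C)\bigr)^{\otimes N}\to I\oplus I$ a channel (a two-outcome measurement). A protocol $\pi$ on $\bar a$ is simple if the honest source sends $N+1$ copies of $\phi$, one through each copy of $\mathcal T$, and if the clients' combs, run on the resources, carry out the following joint algorithm on any states $\rho_0\otimes\dots\otimes\rho_N$ they are sent: draw a register from $\eta$, apply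 $\mu$ to the $N$ other registers (in their order), output the drawn register, each client its share, if the outcome is $0$, and output the abort signal at each client if the outcome is $1$. **Theorem.** Let $\pi$ be a simple protocol as above. Then there exists an attack $A\in\mathcal A(\pi)$ such that for all $B\in\mathcal A(\mathrm{id}_{\mathcal S_\phi})$ with the same source input and output as $A$, $$d\bigl(\pi(\bar a),\sharp_S(\mathcal S_\phi)\bigr)+d\bigl(A(\bar a),B(\mathcal S_\phi)\bigr)\ \ge\ \varepsilon,$$ where $\varepsilon=\frac1{27N}$ if $\phi$ is mixed (not pure) and $\varepsilon=\frac1{8\sqrt N}$ if $\phi$ is pure. -/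

import Mathlib

open scoped Matrix ComplexOrder Kronecker

noncomputable section

namespace QSV

/-! ### Linear maps between matrix algebras -/

/-- Linear maps from `X × X` matrices to `Y × Y` matrices. -/
abbrev Super (X Y : Type) := Matrix X X ℂ →ₗ[ℂ] Matrix Y Y ℂ

/-- Reindexing of rows and columns along `f`. -/
def Super.pull {X Y : Type} (f : Y → X) : Super X Y where
  toFun ρ := ρ.submatrix f f
  map_add' _ _ := rfl
  map_smul' _ _ := rfl

/-- `ρ ↦ V ρ V†`, where `V` is the matrix that sends the basis vector `x` to `f x`. -/
def Super.push {X Y : Type} [Fintype X] [DecidableEq Y] (f : X → Y) : Super X Y where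
  toFun ρ := Matrix.of fun y y' => ∑ x, ∑ x', if f x = y ∧ f x' = y' then ρ x x' else 0
  map_add' ρ σ := by
    ext y y'
    simp only [Matrix.of_apply, Matrix.add_apply, ← Finset.sum_add_distrib]
    refine Finset.sum_congr rfl fun x _ => Finset.sum_congr rfl fun x' _ => ?_
    split_ifs <;> simp
  map_smul' c ρ := by
    ext y y'
    simp only [Matrix.of_apply, Matrix.smul_apply, smul_eq_mul, RingHom.id_apply, Finset.mul_sum]
    refine Finset.sum_congr rfl fun x _ => Finset.sum_congr rfl fun x' _ => ?_
    split_ifs <;> simp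

/-- `Φ ⊗ id_Z`: the map `Φ` is applied to each of the blocks indexed by `Z × Z`. -/
def Super.ampR {X Y : Type} (Z : Type) (Φ : Super X Y) : Super (X × Z) (Y × Z) where
  toFun ρ := Matrix.of fun p q => Φ (Matrix.of fun x x' => ρ (x, p.2) (x', q.2)) p.1 q.1
  map_add' ρ σ := by
    ext p q
    exact congrFun (congrFun (map_add Φ (Matrix.of fun x x' => ρ (x, p.2) (x', q.2))
      (Matrix.of fun x x' => σ (x, p.2) (x', q.2))) p.1) q.1
  map_smul' c ρ := by
    ext p q
    exact congrFun (congrFun (map_smul Φ c (Matrix.of fun x x' => ρ (x, p.2) (x', q.2))) p.1) q.1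

/-- `id_Z ⊗ Φ`. -/
def Super.ampL {X Y : Type} (Z : Type) (Φ : Super X Y) : Super (Z × X) (Z × Y) :=
  Super.pull Prod.swap ∘ₗ Super.ampR Z Φ ∘ₗ Super.pull Prod.swap

/-- `Φ ⊗ Ψ`. -/
def Super.tensor {X Y Z W : Type} (Φ : Super X Y) (Ψ : Super Z W) : Super (X × Z) (Y × W) :=
  Super.ampR W Φ ∘ₗ Super.ampL X Ψ

/-- `⊗ᵢ Φᵢ` for a finite family, computed on the matrix units. -/
def Super.pi {ι : Type} [Fintype ι] [DecidableEq ι] {X Y : ι → Type}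
    [∀ i, Fintype (X i)] [∀ i, DecidableEq (X i)] (Φ : ∀ i, Super (X i) (Y i)) :
    Super (∀ i, X i) (∀ i, Y i) where
  toFun ρ := Matrix.of fun y y' => ∑ x, ∑ x',
    (∏ i, Φ i (Matrix.single (x i) (x' i) 1) (y i) (y' i)) * ρ x x'
  map_add' ρ σ := by
    ext y y'
    simp only [Matrix.of_apply, Matrix.add_apply, mul_add, Finset.sum_add_distrib]
  map_smul' c ρ := by
    ext y y'
    simp only [Matrix.of_apply, Matrix.smul_apply, smul_eq_mul, RingHom.id_apply, Finset.mul_sum]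
    refine Finset.sum_congr rfl fun x _ => Finset.sum_congr rfl fun x' _ => ?_
    ring

/-- `Φ` is completely positive: all maps `Φ ⊗ id_k` preserve positive semidefiniteness. -/
def Super.IsCP {X Y : Type} (Φ : Super X Y) : Prop :=
  ∀ (k : ℕ) (ρ : Matrix (X × Fin k) (X × Fin k) ℂ),
    ρ.PosSemidef → (Super.ampR (Fin k) Φ ρ).PosSemidef

/-- `Φ` preserves the trace. -/
def Super.IsTP {X Y : Type} [Fintype X] [Fintype Y] (Φ : Super X Y) : Prop :=
  ∀ ρ, (Φ ρ).trace = ρ.trace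

/-! ### Diamond distance -/

/-- Density operators on `ℂ^X`. -/
def IsDensity {X : Type} [Fintype X] (ρ : Matrix X X ℂ) : Prop :=
  ρ.PosSemidef ∧ ρ.trace = 1

/-- The trace norm `Tr √(A A†)`: the sum of the square roots of the eigenvalues of `A A†`. -/
def traceNorm {X : Type} [Fintype X] [DecidableEq X] (A : Matrix X X ℂ) : ℝ :=
  ∑ i, √((Matrix.isHermitian_mul_conjTranspose_self A).eigenvalues i)

/-- The diamond distance `‖Φ - Ψ‖⋄`: the maximum over the density operators `ρ` on `X ⊗ X` of the
trace norm of `((Φ - Ψ) ⊗ id) ρ`. -/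
def dia {X Y : Type} [Fintype X] [Fintype Y] [DecidableEq Y] [DecidableEq X]
    (Φ Ψ : Super X Y) : ℝ :=
  sSup {r | ∃ ρ : Matrix (X × X) (X × X) ℂ, IsDensity ρ ∧
    r = traceNorm (Super.ampR X (Φ - Ψ) ρ)}

/-- Half the diamond distance, the distinguishing advantage. -/
def hdia {X Y : Type} [Fintype X] [Fintype Y] [DecidableEq Y] [DecidableEq X]
    (Φ Ψ : Super X Y) : ℝ := dia Φ Ψ / 2

/-! ### The category of finite-dimensional C*-algebras and channels -/

/-- A finite-dimensional C*-algebra, up to isomorphism: the algebra of those complex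
`carrier × carrier` matrices that are block diagonal with respect to the partition `blk`.
It is `⊕ M_n(ℂ)`, with one summand for each class of `blk`, and `n` the size of the class. -/
structure QSys where
  carrier : Type
  [fin : Fintype carrier]
  [dec : DecidableEq carrier]
  blk : Setoid carrier

instance : CoeSort QSys Type := ⟨QSys.carrier⟩
instance (A : QSys) : Fintype A := A.fin
instance (A : QSys) : DecidableEq A := A.dec

/-- The tensor unit `I = ℂ`. -/
abbrev QSys.unit : QSys := ⟨Unit, ⊤⟩

/-- The matrix algebra `M_n(ℂ)`. -/
abbrev QSys.mat (n : ℕ) : QSys := ⟨Fin n, ⊤⟩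

/-- The tensor product of two algebras. -/
abbrev QSys.tensor (A B : QSys) : QSys := ⟨A × B, A.blk.prod B.blk⟩

/-- The tensor product of a finite family of algebras. -/
abbrev QSys.pi {ι : Type} [Fintype ι] [DecidableEq ι] (A : ι → QSys) : QSys :=
  ⟨∀ i, A i, @piSetoid _ _ fun i => (A i).blk⟩

/-- The direct sum of two algebras. -/
abbrev QSys.sum (A B : QSys) : QSys where
  carrier := A ⊕ B
  blk :=
    { r := Sum.LiftRel A.blk.r B.blk.r
      iseqv :=
        { refl := by rintro (a | b) <;> constructor <;> exact Setoid.refl' _ _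
          symm := by rintro _ _ (h | h) <;> constructor <;> exact Setoid.symm' _ h
          trans := by
            rintro _ _ _ (h | h) (h' | h') <;> constructor <;> exact Setoid.trans' _ h h' } }

/-- The classical bit `I ⊕ I`, where `0` is `inl ()` and `1` is `inr ()`. -/
abbrev QSys.bit : QSys := QSys.unit.sum QSys.unit

open Classical in
/-- The conditional expectation of the full matrix algebra onto the block diagonal matrices. -/
abbrev QSys.pinch (A : QSys) (ρ : Matrix A A ℂ) : Matrix A A ℂ :=
  Matrix.of fun x x' => if A.blk x x' then ρ x x' else 0

/-- A state (density operator) of the algebra `A`. -/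
structure State (A : QSys) where
  mat : Matrix A A ℂ
  density : IsDensity mat
  blocks : A.pinch mat = mat

/-- A quantum channel, i.e. a completely positive trace preserving map between the block diagonal
algebras of `A` and `B`. The map is stored through its canonical extension to all matrices: it
ignores the entries outside of the blocks of `A`, and its values are block diagonal for `B`. -/
structure Chan (A B : QSys) where
  map : Super A B
  cp : map.IsCP
  tp : map.IsTP
  map_pinch : ∀ ρ, map (A.pinch ρ) = map ρ
  pinch_map : ∀ ρ, B.pinch (map ρ) = map ρ

theorem QSys.pinch_apply_of {A : QSys} {x x' : A} (h : A.blk x x') (ρ : Matrix A A ℂ) :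
    A.pinch ρ x x' = ρ x x' := by simp [QSys.pinch, h]

theorem QSys.pinch_apply_not {A : QSys} {x x' : A} (h : ¬ A.blk x x') (ρ : Matrix A A ℂ) :
    A.pinch ρ x x' = 0 := by simp [QSys.pinch, h]

theorem QSys.pinch_pinch (A : QSys) (ρ : Matrix A A ℂ) : A.pinch (A.pinch ρ) = A.pinch ρ := by
  ext x x'
  by_cases h : A.blk x x'
  · rw [QSys.pinch_apply_of h]
  · rw [QSys.pinch_apply_not h, QSys.pinch_apply_not h]

theorem QSys.trace_pinch (A : QSys) (ρ : Matrix A A ℂ) : (A.pinch ρ).trace = ρ.trace := by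
  refine Finset.sum_congr rfl fun x _ => ?_
  exact QSys.pinch_apply_of (Setoid.refl' _ x) ρ

theorem QSys.pinch_eq_self {A : QSys} {ρ : Matrix A A ℂ}
    (h : ∀ x x', ¬ A.blk x x' → ρ x x' = 0) : A.pinch ρ = ρ := by
  ext x x'
  by_cases hx : A.blk x x'
  · rw [QSys.pinch_apply_of hx]
  · rw [QSys.pinch_apply_not hx, h x x' hx]

/-- The block indicator matrix of a partition is positive semidefinite. -/
theorem posSemidef_indicator {X : Type} [Fintype X] (s : Setoid X)
    [DecidableRel s.r] :
    (Matrix.of fun x x' => if s.r x x' then (1 : ℂ) else 0).PosSemidef := by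
  classical
  have h := Matrix.posSemidef_self_mul_conjTranspose
    (Matrix.of fun (x : X) (q : Quotient s) => if Quotient.mk s x = q then (1 : ℂ) else 0)
  convert h using 1
  ext x x'
  simp only [Matrix.of_apply, Matrix.mul_apply, Matrix.conjTranspose_apply]
  rw [Finset.sum_eq_single (Quotient.mk s x)]
  · have : s.r x x' ↔ Quotient.mk s x' = Quotient.mk s x := by
      rw [Quotient.eq]; exact ⟨fun h => s.symm' h, fun h => s.symm' h⟩
    by_cases hx : s.r x x'
    · simp [hx, this.1 hx]
    · simp [hx, mt this.2 hx]
  · intro q _ hq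
    simp [Ne.symm hq]
  · simp

theorem posSemidef_kronecker {X Y : Type} [Fintype X] [Fintype Y] {A : Matrix X X ℂ}
    {B : Matrix Y Y ℂ} (hA : A.PosSemidef) (hB : B.PosSemidef) : (A ⊗ₖ B).PosSemidef :=
  hA.kronecker hB

/-- The channel that relabels basis vectors along a bijection `e` that respects the blocks. -/
def Chan.relabel {A B : QSys} (e : B ≃ A) (h : ∀ x x', B.blk x x' ↔ A.blk (e x) (e x')) :
    Chan A B where
  map :=
    { toFun := fun ρ => B.pinch (ρ.submatrix e e)
      map_add' := fun ρ σ => by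
        ext x x'
        by_cases hx : B.blk x x' <;> simp [QSys.pinch, hx]
      map_smul' := fun c ρ => by
        ext x x'
        by_cases hx : B.blk x x' <;> simp [QSys.pinch, hx] }
  cp := by
    classical
    intro k ρ hρ
    have h1 := (posSemidef_kronecker hρ (posSemidef_indicator B.blk)).submatrix
      (fun p : B × Fin k => ((e p.1, p.2), p.1))
    convert h1 using 1
    ext p q
    by_cases hx : B.blk p.1 q.1
    · simp [Super.ampR, QSys.pinch, hx]
    · simp [Super.ampR, QSys.pinch, hx]
  tp := by
    intro ρ
    refine (QSys.trace_pinch _ _).trans ?_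
    exact Equiv.sum_comp e fun x => ρ x x
  map_pinch := by
    intro ρ
    ext x x'
    by_cases hx : B.blk x x'
    · simp [QSys.pinch, hx, ← h]
    · simp [QSys.pinch, hx]
  pinch_map := fun _ => QSys.pinch_pinch _ _

/-- Composition of channels. -/
def Chan.comp {A B C : QSys} (g : Chan B C) (f : Chan A B) : Chan A C where
  map := g.map ∘ₗ f.map
  cp := fun k ρ hρ => g.cp k _ (f.cp k ρ hρ)
  tp := fun ρ => (g.tp _).trans (f.tp ρ)
  map_pinch := fun ρ => congrArg g.map (f.map_pinch ρ)
  pinch_map := fun _ => g.pinch_map _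

/-- The channel that discards its input and prepares the state `σ`. -/
def Chan.prepare (A : QSys) {B : QSys} (σ : State B) : Chan A B where
  map :=
    { toFun := fun ρ => ρ.trace • σ.mat
      map_add' := fun ρ τ => by simp [add_smul]
      map_smul' := fun c ρ => by simp [mul_smul] }
  cp := by
    intro k ρ hρ
    have h1 : (∑ x : A, ρ.submatrix (fun i : Fin k => (x, i)) (fun i => (x, i))).PosSemidef :=
      Matrix.posSemidef_sum _ fun x _ => hρ.submatrix _
    have h2 := posSemidef_kronecker σ.density.1 h1
    convert h2 using 1
    ext p q
    simp [Super.ampR, Matrix.trace, Matrix.sum_apply, mul_comm]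
  tp := by
    intro ρ
    change (ρ.trace • σ.mat).trace = _
    rw [Matrix.trace_smul, σ.density.2, smul_eq_mul, mul_one]
  map_pinch := fun ρ => congrArg (· • σ.mat) (QSys.trace_pinch A ρ)
  pinch_map := fun ρ => by
    refine QSys.pinch_eq_self fun x x' h => ?_
    have := congrFun (congrFun σ.blocks x) x'
    rw [QSys.pinch_apply_not h] at this
    change ρ.trace * σ.mat x x' = 0
    rw [← this, mul_zero]

/-- The channel that reads a bit `c` and prepares the state `σ₀` if `c = 0` and `σ₁` if `c = 1`. -/
def Chan.choose {B : QSys} (σ₀ σ₁ : State B) : Chan QSys.bit B where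
  map :=
    { toFun := fun ρ => ρ (.inl ()) (.inl ()) • σ₀.mat + ρ (.inr ()) (.inr ()) • σ₁.mat
      map_add' := fun ρ τ => by
        simp only [Matrix.add_apply, add_smul]; abel
      map_smul' := fun c ρ => by simp [mul_smul] }
  cp := by
    intro k ρ hρ
    have h0 := posSemidef_kronecker σ₀.density.1
      (hρ.submatrix (fun i : Fin k => ((Sum.inl () : QSys.bit), i)))
    have h1 := posSemidef_kronecker σ₁.density.1
      (hρ.submatrix (fun i : Fin k => ((Sum.inr () : QSys.bit), i)))
    convert h0.add h1 using 1
    ext p q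
    simp [Super.ampR, mul_comm]
  tp := by
    intro ρ
    change (_ • σ₀.mat + _ • σ₁.mat).trace = ∑ x : Unit ⊕ Unit, ρ x x
    rw [Matrix.trace_add, Matrix.trace_smul, Matrix.trace_smul, σ₀.density.2, σ₁.density.2]
    simp
  map_pinch := fun ρ => by
    change QSys.bit.pinch ρ _ _ • σ₀.mat + QSys.bit.pinch ρ _ _ • σ₁.mat = _
    rw [QSys.pinch_apply_of (Setoid.refl' _ _), QSys.pinch_apply_of (Setoid.refl' _ _)]
    rfl
  pinch_map := fun ρ => by
    refine QSys.pinch_eq_self fun x x' h => ?_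
    have h0 := congrFun (congrFun σ₀.blocks x) x'
    have h1 := congrFun (congrFun σ₁.blocks x) x'
    rw [QSys.pinch_apply_not h] at h0 h1
    change _ * σ₀.mat x x' + _ * σ₁.mat x x' = 0
    rw [← h0, ← h1, mul_zero, mul_zero, add_zero]

/-- The channel `f ⊗ id_Z`, where `Z` is a full matrix algebra (`hZ`). -/
def Chan.ampR {A B : QSys} (f : Chan A B) (Z : QSys) (hZ : Z.blk = ⊤) :
    Chan (A.tensor Z) (B.tensor Z) where
  map := Super.ampR Z f.map
  cp := by
    intro k ρ hρ
    let e := Fintype.equivFin (Z × Fin k)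
    have h1 := (f.cp _ _ (hρ.submatrix
      (fun p : A × Fin (Fintype.card (Z × Fin k)) => ((p.1, (e.symm p.2).1), (e.symm p.2).2)))
      ).submatrix (fun p : (B × Z) × Fin k => (p.1.1, e (p.1.2, p.2)))
    convert h1 using 1
    ext p q
    simp [Super.ampR]
  tp := by
    intro ρ
    change ∑ p : B × Z, _ = ∑ p : A × Z, _
    rw [Fintype.sum_prod_type_right, Fintype.sum_prod_type_right]
    exact Finset.sum_congr rfl fun z _ => f.tp (Matrix.of fun x x' => ρ (x, z) (x', z))
  map_pinch := fun ρ => by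
    have hz : ∀ z z' : Z, Z.blk z z' := fun z z' => by rw [hZ]; trivial
    ext p q
    have h1 : (Matrix.of fun x x' => (A.tensor Z).pinch ρ (x, p.2) (x', q.2)) =
        A.pinch (Matrix.of fun x x' => ρ (x, p.2) (x', q.2)) := by
      ext x x'
      by_cases hx : A.blk x x'
      · rw [QSys.pinch_apply_of hx]
        exact QSys.pinch_apply_of (A := A.tensor Z) (x := (x, p.2)) (x' := (x', q.2))
          ⟨hx, hz _ _⟩ ρ
      · rw [QSys.pinch_apply_not hx]
        exact QSys.pinch_apply_not (A := A.tensor Z) (x := (x, p.2)) (x' := (x', q.2))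
          (fun h => hx h.1) ρ
    change f.map (Matrix.of fun x x' => (A.tensor Z).pinch ρ (x, p.2) (x', q.2)) p.1 q.1 = _
    rw [h1, f.map_pinch]
    rfl
  pinch_map := fun ρ => by
    refine QSys.pinch_eq_self fun p q h => ?_
    have hz : ∀ z z' : Z, Z.blk z z' := fun z z' => by rw [hZ]; trivial
    have hx : ¬ B.blk p.1 q.1 := fun hx => h ⟨hx, hz _ _⟩
    have h1 := congrFun (congrFun
      (f.pinch_map (Matrix.of fun x x' => ρ (x, p.2) (x', q.2))) p.1) q.1
    rw [QSys.pinch_apply_not hx] at h1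
    exact h1.symm

/-- The identity channel. -/
def Chan.id (A : QSys) : Chan A A := Chan.relabel (Equiv.refl _) fun _ _ => Iff.rfl

/-- The unitor `A ≅ A ⊗ I`. -/
def Chan.unitor (A : QSys) : Chan A (A.tensor QSys.unit) :=
  Chan.relabel (A := A) (B := A.tensor QSys.unit)
    ⟨Prod.fst, fun a => (a, ()), fun _ => rfl, fun _ => rfl⟩
    fun _ _ => ⟨fun h => h.1, fun h => ⟨h, trivial⟩⟩

/-- The inverse unitor `A ⊗ I ≅ A`. -/
def Chan.unitorInv (A : QSys) : Chan (A.tensor QSys.unit) A :=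
  Chan.relabel (A := A.tensor QSys.unit) (B := A)
    ⟨fun a => (a, ()), Prod.fst, fun _ => rfl, fun _ => rfl⟩
    fun _ _ => ⟨fun h => ⟨h, trivial⟩, fun h => h.1⟩

theorem posSemidef_push {X Y : Type} [Fintype X] [Fintype Y] [DecidableEq Y] (f : X → Y)
    {ρ : Matrix X X ℂ} (h : ρ.PosSemidef) : (Super.push f ρ).PosSemidef := by
  have h1 := h.mul_mul_conjTranspose_same
    (Matrix.of fun (y : Y) (x : X) => if f x = y then (1 : ℂ) else 0)
  have h2 : Super.push f ρ = (Matrix.of fun (y : Y) (x : X) => if f x = y then (1 : ℂ) else 0) * ρ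
      * (Matrix.of fun (y : Y) (x : X) => if f x = y then (1 : ℂ) else 0)ᴴ := by
    ext y y'
    simp only [Super.push, LinearMap.coe_mk, AddHom.coe_mk, Matrix.of_apply, Matrix.mul_apply,
      Matrix.conjTranspose_apply, Finset.sum_mul]
    rw [Finset.sum_comm]
    refine Finset.sum_congr rfl fun x _ => Finset.sum_congr rfl fun x' _ => ?_
    by_cases h1 : f x' = y <;> by_cases h2 : f x = y' <;> simp [h1, h2]
  rw [h2]
  exact h1

/-- The unique state of the tensor unit. -/
def State.one : State QSys.unit where
  mat := 1
  density := ⟨Matrix.PosSemidef.one, by simp⟩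
  blocks := QSys.pinch_eq_self fun _ _ h => (h trivial).elim

/-- The state of `A ⊕ B` supported on the summand `A`. -/
def State.inl {A : QSys} (B : QSys) (σ : State A) : State (A.sum B) where
  mat := Matrix.fromBlocks σ.mat 0 0 0
  density := by
    refine ⟨?_, by
      rw [← σ.density.2]
      simp [Matrix.trace, Fintype.sum_sum_type]⟩
    have h : Super.push Sum.inl σ.mat =
        (Matrix.fromBlocks σ.mat 0 0 0 : Matrix (A ⊕ B) (A ⊕ B) ℂ) := by
      ext (x | x) (y | y) <;> simp [Super.push, ite_and]
    rw [← h]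
    exact posSemidef_push _ σ.density.1
  blocks := by
    refine QSys.pinch_eq_self ?_
    rintro (a | b) (a' | b') h
    · have h1 := congrFun (congrFun σ.blocks a) a'
      rw [QSys.pinch_apply_not fun h' => h (Sum.LiftRel.inl h')] at h1
      exact h1.symm
    all_goals rfl

/-- The state of `A ⊕ B` supported on the summand `B`. -/
def State.inr (A : QSys) {B : QSys} (σ : State B) : State (A.sum B) where
  mat := Matrix.fromBlocks 0 0 0 σ.mat
  density := by
    refine ⟨?_, by
      rw [← σ.density.2]
      simp [Matrix.trace, Fintype.sum_sum_type]⟩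
    have h : Super.push Sum.inr σ.mat =
        (Matrix.fromBlocks 0 0 0 σ.mat : Matrix (A ⊕ B) (A ⊕ B) ℂ) := by
      ext (x | x) (y | y) <;> simp [Super.push, ite_and]
    rw [← h]
    exact posSemidef_push _ σ.density.1
  blocks := by
    refine QSys.pinch_eq_self ?_
    rintro (a | b) (a' | b') h
    on_goal 4 =>
      have h1 := congrFun (congrFun σ.blocks b) b'
      rw [QSys.pinch_apply_not fun h' => h (Sum.LiftRel.inr h')] at h1
      exact h1.symm
    all_goals rfl

/-! ### Combs, protocols and the attack model -/

/-- One party's part of a comb. The list holds the types `(A, B)` of the holes in the order in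
which they are called. In each step the party turns its current system into an input `A` of the
next hole and a memory `Y`; the hole returns `B`, and the current system becomes `B ⊗ Y`. -/
inductive Comb : List (QSys × QSys) → QSys → QSys → Type 1
  | close {C D : QSys} (g : Chan C D) : Comb [] C D
  | step {h : QSys × QSys} {l : List (QSys × QSys)} {C D : QSys} (Y : QSys)
      (g : Chan C (h.1.tensor Y)) (rest : Comb l (h.2.tensor Y) D) : Comb (h :: l) C D

/-- The last channel of a comb without holes. -/
def Comb.last {C D : QSys} : Comb [] C D → Chan C D
  | .close g => g

/-- The memory kept during the first hole. -/
def Comb.mem {h : QSys × QSys} {l : List (QSys × QSys)} {C D : QSys} :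
    Comb (h :: l) C D → QSys
  | .step Y _ _ => Y

/-- The channel before the first hole. -/
def Comb.first {h : QSys × QSys} {l : List (QSys × QSys)} {C D : QSys} :
    (x : Comb (h :: l) C D) → Chan C (h.1.tensor x.mem)
  | .step _ g _ => g

/-- The comb after the first hole. -/
def Comb.rest {h : QSys × QSys} {l : List (QSys × QSys)} {C D : QSys} :
    (x : Comb (h :: l) C D) → Comb l (h.2.tensor x.mem) D
  | .step _ _ r => r

/-- The type of a resource shared by `K` clients and a source: the inputs and the outputs. -/
structure Iface (K : ℕ) where
  cin : Fin K → QSys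
  cout : Fin K → QSys
  sin : QSys
  sout : QSys

/-- All the inputs of the resource. -/
abbrev Iface.dom {K : ℕ} (x : Iface K) : QSys := (QSys.pi x.cin).tensor x.sin

/-- All the outputs of the resource. -/
abbrev Iface.cod {K : ℕ} (x : Iface K) : QSys := (QSys.pi x.cout).tensor x.sout

/-- A resource: a channel shared by `K` clients and a source. -/
structure Resource (K : ℕ) where
  iface : Iface K
  chan : Chan iface.dom iface.cod

/-- The holes of client `i`, when the resources are called in the order `o`. -/
abbrev clientHoles {K : ℕ} {J : Type} (ty : J → Iface K) (i : Fin K) (o : List J) :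
    List (QSys × QSys) := o.map fun j => ((ty j).cin i, (ty j).cout i)

/-- The holes of the source, when the resources are called in the order `o`. -/
abbrev sourceHoles {K : ℕ} {J : Type} (ty : J → Iface K) (o : List J) :
    List (QSys × QSys) := o.map fun j => ((ty j).sin, (ty j).sout)

/-- A protocol for `K` clients and a source that uses resources of the types `ty` in order to
build a resource with client inputs `c`, client outputs `d`, source input `s` and source output
`t`. The parties agree on the order in which resources are called, each of them at most once;
otherwise each party acts on its own, by channels on its own systems. -/
structure Protocol {K : ℕ} {J : Type} (ty : J → Iface K) (c d : Fin K → QSys) (s t : QSys) where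
  order : List J
  nodup : order.Nodup
  client : ∀ i, Comb (clientHoles ty i order) (c i) (d i)
  source : Comb (sourceHoles ty order) s t

/-- Replace the source's part of the protocol. -/
def Protocol.withSource {K : ℕ} {J : Type} {ty : J → Iface K} {c d : Fin K → QSys} {s t : QSys}
    (π : Protocol ty c d s t) {s' t' : QSys} (x : Comb (sourceHoles ty π.order) s' t') :
    Protocol ty c d s' t' :=
  ⟨π.order, π.nodup, π.client, x⟩

/-- The attacks of a malicious source (with arbitrary input `s'` and output `t'`) on a protocol:
the order of the calls and the clients' parts are kept, the source's part is arbitrary. -/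
def Protocol.attacks {K : ℕ} {J : Type} {ty : J → Iface K} {c d : Fin K → QSys} {s t : QSys}
    (π : Protocol ty c d s t) (s' t' : QSys) : Set (Protocol ty c d s' t') :=
  Set.range fun x => π.withSource x

/-- The map obtained by filling the holes of all the parties' combs with the resources `r`. -/
def fill {K : ℕ} {J : Type} (r : J → Resource K) : (o : List J) →
    {c d : Fin K → QSys} → {s t : QSys} →
    (∀ i, Comb (clientHoles (fun j => (r j).iface) i o) (c i) (d i)) →
    Comb (sourceHoles (fun j => (r j).iface) o) s t →
    Super ((QSys.pi c).tensor s) ((QSys.pi d).tensor t)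
  | [], _, _, _, _, x, y => Super.tensor (Super.pi fun i => (x i).last.map) y.last.map
  | j :: o, _, _, _, _, x, y =>
    fill r o (fun i => (x i).rest) y.rest ∘ₗ
      Super.pull (fun p =>
        (((fun i => (p.1 i).1), p.2.1), ((fun i => (p.1 i).2), p.2.2))) ∘ₗ
      Super.ampR ((∀ i, (x i).mem) × y.mem) (r j).chan.map ∘ₗ
      Super.pull (fun p => ((fun i => (p.1.1 i, p.2.1 i)), (p.1.2, p.2.2))) ∘ₗ
      Super.tensor (Super.pi fun i => (x i).first.map) y.first.map

/-- The process `π(r)` obtained by running the protocol `π` on the resources `r`. -/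
def Protocol.eval {K : ℕ} {J : Type} {r : J → Resource K} {c d : Fin K → QSys} {s t : QSys}
    (π : Protocol (fun j => (r j).iface) c d s t) :
    Super ((QSys.pi c).tensor s) ((QSys.pi d).tensor t) :=
  fill r π.order π.client π.source

/-- The identity comb with one hole. -/
def Comb.id (A B : QSys) : Comb [(A, B)] A B :=
  .step QSys.unit (Chan.unitor A) (.close (Chan.unitorInv B))

/-- The identity protocol on a resource. -/
def Protocol.id {K : ℕ} (x : Iface K) :
    Protocol (fun _ : Unit => x) x.cin x.cout x.sin x.sout where
  order := [()]
  nodup := List.nodup_singleton _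
  client i := Comb.id (x.cin i) (x.cout i)
  source := Comb.id x.sin x.sout

/-! ### The ideal resource and its filter -/

/-- The algebra `⊗ᵢ M_{nᵢ}(ℂ)` of the target state. -/
abbrev target {K : ℕ} (n : Fin K → ℕ) : QSys := QSys.pi fun i => QSys.mat (n i)

/-- Client `i` ends with its share of a state, or with the signal `I`. -/
abbrev clientOut {K : ℕ} (n : Fin K → ℕ) (i : Fin K) : QSys := (QSys.mat (n i)).sum QSys.unit

/-- The inclusion of `(⊗ᵢ M_{nᵢ}) ⊕ (⊗ᵢ I)` as a direct summand of `⊗ᵢ (M_{nᵢ} ⊕ I)`, on basis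
vectors: all the clients obtain their shares, or all the clients obtain the signal. -/
def outLabel {K : ℕ} (n : Fin K → ℕ) : (target n).sum QSys.unit → QSys.pi (clientOut n)
  | .inl x => fun i => .inl (x i)
  | .inr _ => fun _ => .inr ()

/-- Hand out a state of `(⊗ᵢ M_{nᵢ}) ⊕ I` to the clients. -/
def State.distribute {K : ℕ} {n : Fin K → ℕ} (σ : State ((target n).sum QSys.unit)) :
    State (QSys.pi (clientOut n)) where
  mat := Super.push (outLabel n) σ.mat
  density := by
    refine ⟨posSemidef_push _ σ.density.1, ?_⟩
    have key : ∀ x x', outLabel n x = outLabel n x' → x ≠ x' → σ.mat x x' = 0 := by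
      rintro (x | x) (x' | x') h hne
      · refine (hne (congrArg _ (funext fun i => ?_))).elim
        exact Sum.inl_injective (congrFun h i)
      · rw [← σ.blocks]
        exact QSys.pinch_apply_not (fun h' => by cases h') _
      · rw [← σ.blocks]
        exact QSys.pinch_apply_not (fun h' => by cases h') _
      · exact (hne rfl).elim
    rw [← σ.density.2]
    change ∑ y, ∑ x, ∑ x', _ = ∑ x, σ.mat x x
    rw [Finset.sum_comm]
    refine Finset.sum_congr rfl fun x _ => ?_
    rw [Finset.sum_comm, Finset.sum_eq_single x]
    · simp
    · intro x' _ hne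
      refine Finset.sum_eq_zero fun y _ => ?_
      split_ifs with h
      · exact key x x' (h.1.trans h.2.symm) (Ne.symm hne)
      · rfl
    · simp
  blocks := by
    refine QSys.pinch_eq_self fun y y' h => ?_
    refine Finset.sum_eq_zero fun x _ => Finset.sum_eq_zero fun x' _ => ?_
    split_ifs with h'
    · obtain ⟨rfl, rfl⟩ := h'
      rw [← σ.blocks]
      refine QSys.pinch_apply_not (fun hx => h ?_) _
      rcases hx with hx | hx
      · exact fun i => Sum.LiftRel.inl trivial
      · exact fun i => Sum.LiftRel.inr trivial
    · rfl

/-- The type of the ideal resource: no inputs of the clients, a bit from the source. -/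
abbrev idealIface {K : ℕ} (n : Fin K → ℕ) : Iface K where
  cin _ := QSys.unit
  cout := clientOut n
  sin := QSys.bit
  sout := QSys.unit

/-- The ideal resource of quantum state verification: if the source inputs `0`, the clients obtain
the target state `φ`; if it inputs `1`, they obtain the abort signal. -/
def ideal {K : ℕ} {n : Fin K → ℕ} (φ : State (target n)) : Resource K where
  iface := idealIface n
  chan := (Chan.unitor _).comp <|
    (Chan.choose (State.inl QSys.unit φ).distribute
      (State.inr (target n) State.one).distribute).comp <|
    Chan.relabel (A := (QSys.pi fun _ : Fin K => QSys.unit).tensor QSys.bit) (B := QSys.bit)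
      ⟨fun b => (fun _ => (), b), Prod.snd, fun _ => rfl, fun _ => rfl⟩
      fun _ _ => ⟨fun h => ⟨fun _ => trivial, h⟩, fun h => h.2⟩

/-- The filter for an honest source: the source always inputs `0`, the clients do nothing. -/
def filter {K : ℕ} (n : Fin K → ℕ) :
    Protocol (fun _ : Unit => idealIface n) (fun _ => QSys.unit) (clientOut n)
      QSys.unit QSys.unit :=
  (Protocol.id (idealIface n)).withSource <|
    .step QSys.unit
      ((Chan.unitor _).comp (Chan.prepare QSys.unit (State.inl QSys.unit State.one)))
      (.close (Chan.unitorInv QSys.unit))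

/-! ### The resources of the simple protocol -/

/-- The resource `T`: the source inputs a state of `⊗ᵢ M_{nᵢ}(ℂ)`, and its shares are delivered to
the clients. Moreover the clients may communicate by the channel `E`. -/
def distribution {K : ℕ} (n : Fin K → ℕ) {a e : Fin K → QSys}
    (E : Chan (QSys.pi a) (QSys.pi e)) : Resource K where
  iface :=
    { cin := a
      cout := fun i => (QSys.mat (n i)).tensor (e i)
      sin := target n
      sout := QSys.unit }
  chan := Chan.comp
    (Chan.relabel (A := (QSys.pi e).tensor (target n))
      (B := (QSys.pi fun i => (QSys.mat (n i)).tensor (e i)).tensor QSys.unit)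
      ⟨fun p => (fun i => (p.1 i).2, fun i => (p.1 i).1),
        fun q => (fun i => (q.2 i, q.1 i), ()), fun _ => rfl, fun _ => rfl⟩
      fun _ _ => ⟨fun h => ⟨fun i => (h.1 i).2, fun _ => trivial⟩,
        fun h => ⟨fun i => ⟨trivial, h.1 i⟩, trivial⟩⟩)
    (E.ampR (target n) (by
      ext x y
      exact ⟨fun _ => trivial, fun _ _ => trivial⟩))

/-- The resource `W`: the clients, without the source, share the channel `W`. -/
def coordination {K : ℕ} {w w' : Fin K → QSys}
    (W : Chan (QSys.pi w) (QSys.pi w')) : Resource K where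
  iface := { cin := w, cout := w', sin := QSys.unit, sout := QSys.unit }
  chan := W.ampR QSys.unit rfl

/-- The list of resources `(T, …, T, W)`, with `N + 1` copies of `T`. -/
def resources {K : ℕ} (N : ℕ) (T W : Resource K) : Fin (N + 1) ⊕ Unit → Resource K
  | .inl _ => T
  | .inr _ => W

/-! ### Simple protocols -/

/-- The source's comb that inputs the state `ρ k` into the `k`-th copy of `T`, and nothing else.
(As an operation on the resources it does not matter whether a product state is prepared at the
beginning, or each of its factors when it is sent.) -/
def sendStates {K N : ℕ} {n : Fin K → ℕ} {a e w w' : Fin K → QSys}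
    (E : Chan (QSys.pi a) (QSys.pi e)) (W : Chan (QSys.pi w) (QSys.pi w'))
    (ρ : Fin (N + 1) → State (target n)) :
    (o : List (Fin (N + 1) ⊕ Unit)) → (s : QSys) →
    Comb (sourceHoles (fun j => (resources N (distribution n E) (coordination W) j).iface) o)
      s QSys.unit
  | [], s => .close (Chan.prepare s State.one)
  | .inl k :: o, s =>
    .step QSys.unit ((Chan.unitor (target n)).comp (Chan.prepare s (ρ k)))
      (sendStates E W ρ o _)
  | .inr _ :: o, s =>
    .step QSys.unit ((Chan.unitor QSys.unit).comp (Chan.prepare s State.one))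
      (sendStates E W ρ o _)

/-- The product of `ρ₀, …, ρ_N`. -/
def productState {N : ℕ} {A : QSys} (ρ : Fin (N + 1) → State A) :
    Matrix (Fin (N + 1) → A) (Fin (N + 1) → A) ℂ :=
  Matrix.of fun x y => ∏ k, (ρ k).mat (x k) (y k)

/-- Move register `r` of `N + 1` registers to the end; the order of the others is kept. -/
def moveBack {N : ℕ} (A : QSys) (r : Fin (N + 1)) :
    Super (Fin (N + 1) → A) ((Fin N → A) × A) :=
  Super.pull fun p => Fin.insertNth (α := fun _ => (A : Type)) r p.2 p.1

/-- Keep the state if the bit is `0`; replace it by the signal `I` if the bit is `1`. -/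
def keepOrAbort (A : QSys) : Super (QSys.bit.tensor A) (A.sum QSys.unit) where
  toFun ρ := Matrix.fromBlocks
    (Matrix.of fun x x' => ρ (.inl (), x) (.inl (), x')) 0 0
    (Matrix.of fun _ _ => ∑ x, ρ (.inr (), x) (.inr (), x))
  map_add' ρ σ := by
    ext (x | x) (x' | x') <;> simp [Finset.sum_add_distrib]
  map_smul' c ρ := by
    ext (x | x) (x' | x') <;> simp [Finset.mul_sum]

/-- The joint algorithm of the clients: sample the output register from `η` and move it to the
end, measure the first `N` registers by `μ`, and output the last register if the outcome is `0`
and the abort signal if the outcome is `1`. -/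
def clientAlgorithm {K N : ℕ} {n : Fin K → ℕ} (η : Fin (N + 1) → ℝ)
    (μ : Chan (QSys.pi fun _ : Fin N => target n) QSys.bit) :
    Super (Fin (N + 1) → target n) (QSys.pi (clientOut n)) :=
  Super.push (outLabel n) ∘ₗ keepOrAbort (target n) ∘ₗ Super.ampR (target n) μ.map ∘ₗ
    ∑ r, (η r : ℂ) • moveBack (target n) r

/-- `π` is a simple protocol for the target state `φ`, with the distribution `η` of the output
register and the measurement `μ`. The source sends copies of `φ`. Whichever states `ρ₀, …, ρ_N`
are sent to the clients, the clients' parts of the protocol, run on the resources, carry out the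
joint algorithm of the clients. -/
structure IsSimple {K N : ℕ} {n : Fin K → ℕ} {a e w w' : Fin K → QSys}
    {E : Chan (QSys.pi a) (QSys.pi e)} {W : Chan (QSys.pi w) (QSys.pi w')}
    (φ : State (target n)) (η : Fin (N + 1) → ℝ)
    (μ : Chan (QSys.pi fun _ : Fin N => target n) QSys.bit)
    (π : Protocol (fun j => (resources N (distribution n E) (coordination W) j).iface)
      (fun _ => QSys.unit) (clientOut n) QSys.unit QSys.unit) : Prop where
  prob : η ∈ stdSimplex ℝ (Fin (N + 1))
  source : π.source = sendStates E W (fun _ => φ) π.order QSys.unit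
  client : ∀ ρ : Fin (N + 1) → State (target n),
    (π.withSource (sendStates E W ρ π.order QSys.unit)).eval 1 =
      (clientAlgorithm η μ (productState ρ)).submatrix Prod.fst Prod.fst

/-- `φ` is pure: `φ = |ψ⟩⟨ψ|` for some vector `ψ`. Otherwise `φ` is mixed. -/
def State.IsPure {A : QSys} (φ : State A) : Prop :=
  ∃ ψ : A → ℂ, φ.mat = Matrix.vecMulVec ψ (star ψ)

end QSV

end

/-! A cheating source sends one slightly wrong state `τ` in every register. Since the registers
agree, the random draw does not matter, and the clients end with `τ` with probability `p`, the
acceptance probability of `tensorPower N τ.mat`, and with the abort signal otherwise. With trivial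
outer systems, a simulator on the ideal resource controls only the distribution of the bit, so it
can produce nothing but mixtures of `φ` and abort.

Two tests bound the two distances from below. For honest use, testing for abort gives the
completeness error `1 - p₀`, where `p₀` is the acceptance probability for copies of `φ`. For the
attack, the test is a reflection `2|v⟩⟨v| - 1` on the state part and the constant `2q - 1` on abort,
with `q = ⟨v|φ|v⟩`. All simulators then give the same value `2q - 1`, and with `r = ⟨v|τ|v⟩` the
advantage is `p(r - q)`. Hence the sum of the distances is at least `1 - p₀ + p(r - q)`
(`exists_attack_le_hdia_add_hdia`). It remains to choose `τ` at a noticeable distance from `φ` while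
`p` stays comparable to `p₀`.

Mixing: `τ` has weight `1 - s` on `φ` and `s` on a basis vector that `φ` populates with weight at
most 1/2. Since `τ ≥ (1 - s)φ`, and tensor powers are monotone on positive matrices, `p ≥ (1 - s)^N
p₀`. Thus `s` of order `1/N` is affordable, and the gain `r - q` is of the same order
(`exists_mixing_attack`).

Rotation: if `φ` is pure, rotate it by an angle `θ`. The overlap of the `N`-fold powers is `cos θ ^
N`, which stays near 1 for `θ` of order `1/√N`, while the two single states differ by `sin θ` in
trace distance (`exists_rotation_attack`). This is the quadratic improvement in the pure case. -/

noncomputable section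

namespace QSV

/-! ### Lower bounds for the trace norm and the diamond distance -/

/-- `T` does not increase the Euclidean norm. -/
def IsContraction {Z : Type} [Fintype Z] (T : Matrix Z Z ℂ) : Prop :=
  ∀ v : Z → ℂ, ∑ z, ‖(T *ᵥ v) z‖ ^ 2 ≤ ∑ z, ‖v z‖ ^ 2

theorem re_dotProduct_le_sqrt_mul_sqrt {Z : Type} [Fintype Z] (a b : Z → ℂ) :
    (a ⬝ᵥ b).re ≤ √(∑ z, ‖a z‖ ^ 2) * √(∑ z, ‖b z‖ ^ 2) := by
  refine le_trans ?_ (Real.sum_mul_le_sqrt_mul_sqrt _ (fun z => ‖a z‖) fun z => ‖b z‖)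
  rw [dotProduct, Complex.re_sum]
  exact Finset.sum_le_sum fun z _ => (Complex.re_le_norm _).trans (norm_mul _ _).le

theorem sum_comp_injective_le {X Z : Type} [Fintype X] [Fintype Z] {g : Z → X}
    (hg : Function.Injective g) {f : X → ℝ} (hf : ∀ x, 0 ≤ f x) : ∑ z, f (g z) ≤ ∑ x, f x := by
  classical
  rw [← Finset.sum_image (f := f) (s := Finset.univ) (g := g) fun _ _ _ _ h => hg h]
  exact Finset.sum_le_sum_of_subset_of_nonneg (Finset.subset_univ _) fun x _ _ => hf x

/-- Duality of the trace norm and the operator norm, one direction, for a compression of `A`. -/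
theorem re_trace_mul_submatrix_le_traceNorm {X Z : Type} [Fintype X] [DecidableEq X] [Fintype Z]
    (A : Matrix X X ℂ) {g : Z → X} (hg : Function.Injective g) {T : Matrix Z Z ℂ}
    (hT : IsContraction T) : (T * A.submatrix g g).trace.re ≤ traceNorm A := by
  have hA := Matrix.isHermitian_mul_conjTranspose_self A
  set U : Matrix X X ℂ := hA.eigenvectorUnitary.1 with hU
  have hUU : U * Uᴴ = 1 := (Matrix.mem_unitaryGroup_iff).1 hA.eigenvectorUnitary.2
  have hUU' : Uᴴ * U = 1 := (Matrix.mem_unitaryGroup_iff').1 hA.eigenvectorUnitary.2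
  have hdiag : (Uᴴ * A) * (Uᴴ * A)ᴴ =
      Matrix.diagonal (fun i => (hA.eigenvalues i : ℂ)) := by
    have h1 := hA.spectral_theorem
    rw [Unitary.conjStarAlgAut_apply] at h1
    change A * Aᴴ = U * _ * Uᴴ at h1
    have h2 := congrArg (fun M => Uᴴ * M * U) h1
    simp only [Matrix.mul_assoc, hUU', Matrix.mul_one] at h2
    rw [Matrix.conjTranspose_mul, Matrix.conjTranspose_conjTranspose, Matrix.mul_assoc, h2,
      ← Matrix.mul_assoc, hUU', Matrix.one_mul]
    rfl
  have hrow : ∀ i, ∑ x, ‖(Uᴴ * A) i x‖ ^ 2 = hA.eigenvalues i := by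
    intro i
    have h1 := congrFun (congrFun hdiag i) i
    rw [Matrix.diagonal_apply_eq, Matrix.mul_apply] at h1
    apply Complex.ofReal_injective
    rw [← h1, Complex.ofReal_sum]
    refine Finset.sum_congr rfl fun x _ => ?_
    rw [Matrix.conjTranspose_apply, Complex.star_def, Complex.mul_conj, Complex.normSq_eq_norm_sq]
  have hcol : ∀ i, ∑ x, ‖U x i‖ ^ 2 = 1 := by
    intro i
    have h1 := congrFun (congrFun hUU' i) i
    rw [Matrix.one_apply_eq, Matrix.mul_apply] at h1
    apply Complex.ofReal_injective
    rw [Complex.ofReal_one, ← h1, Complex.ofReal_sum]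
    refine Finset.sum_congr rfl fun x _ => ?_
    rw [Matrix.conjTranspose_apply, mul_comm, Complex.star_def, Complex.mul_conj,
      Complex.normSq_eq_norm_sq]
  -- With `A = U (Uᴴ A)`, the trace splits over the eigenvectors of `A Aᴴ`. Cauchy-Schwarz bounds
  -- the `i`-th term by a unit column of `U`, shortened by `T`, times a row of norm `√λᵢ`;
  -- restricting along `g` only drops entries.
  have htr : (T * A.submatrix g g).trace =
      ∑ i, (T *ᵥ fun z => U (g z) i) ⬝ᵥ fun z => (Uᴴ * A) i (g z) := by
    have h1 : A = U * (Uᴴ * A) := by rw [← Matrix.mul_assoc, hUU, Matrix.one_mul]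
    have h2 : A.submatrix g g = (U.submatrix g id) * ((Uᴴ * A).submatrix id g) := by
      conv_lhs => rw [h1]
      rfl
    rw [h2, ← Matrix.mul_assoc, Matrix.trace]
    simp only [Matrix.diag_apply, dotProduct]
    rw [Finset.sum_comm]
    rfl
  rw [htr, Complex.re_sum]
  refine Finset.sum_le_sum fun i _ => ?_
  refine (re_dotProduct_le_sqrt_mul_sqrt _ _).trans ?_
  have h1 : √(∑ z, ‖(T *ᵥ fun z => U (g z) i) z‖ ^ 2) ≤ 1 := by
    rw [Real.sqrt_le_one, ← hcol i]
    exact (hT _).trans (sum_comp_injective_le hg (f := fun x => ‖U x i‖ ^ 2) fun _ => by positivity)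
  have h2 : √(∑ z, ‖(Uᴴ * A) i (g z)‖ ^ 2) ≤ √(hA.eigenvalues i) := by
    refine Real.sqrt_le_sqrt ?_
    rw [← hrow i]
    exact sum_comp_injective_le hg (f := fun x => ‖(Uᴴ * A) i x‖ ^ 2) fun _ => by positivity
  calc _ ≤ 1 * √(hA.eigenvalues i) := mul_le_mul h1 h2 (Real.sqrt_nonneg _) zero_le_one
    _ = _ := one_mul _

/-- A one-dimensional input has a single density operator, so the supremum in `dia` runs over one
value. -/
theorem re_trace_mul_submatrix_le_hdia {X Y Z : Type} [Fintype X] [DecidableEq X]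
    [Subsingleton X] [Fintype Y] [DecidableEq Y] [Fintype Z] (x₀ : X) (Φ Ψ : Super X Y)
    {g : Z → Y} (hg : Function.Injective g) {T : Matrix Z Z ℂ} (hT : IsContraction T) :
    (T * (Φ 1 - Ψ 1).submatrix g g).trace.re / 2 ≤ hdia Φ Ψ := by
  have huniq : ∀ ρ : Matrix (X × X) (X × X) ℂ, IsDensity ρ → ρ = 1 := by
    intro ρ hρ
    ext p q
    obtain rfl := Subsingleton.elim p q
    have h := hρ.2
    rw [Matrix.trace, Fintype.sum_subsingleton _ p] at h
    rw [Matrix.one_apply_eq]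
    exact h
  have hone : IsDensity (1 : Matrix (X × X) (X × X) ℂ) :=
    ⟨Matrix.PosSemidef.one, by rw [Matrix.trace, Fintype.sum_subsingleton _ (x₀, x₀)]; simp⟩
  have hset : {r | ∃ ρ : Matrix (X × X) (X × X) ℂ, IsDensity ρ ∧
      r = traceNorm (Super.ampR X (Φ - Ψ) ρ)} = {traceNorm (Super.ampR X (Φ - Ψ) 1)} := by
    ext r
    constructor
    · rintro ⟨ρ, hρ, rfl⟩
      rw [huniq ρ hρ]
      rfl
    · rintro rfl
      exact ⟨1, hone, rfl⟩
  have hsub : (Φ 1 - Ψ 1).submatrix g g =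
      (Super.ampR X (Φ - Ψ) 1).submatrix (fun z => (g z, x₀)) fun z => (g z, x₀) := by
    have h1 : (Matrix.of fun x x' => (1 : Matrix (X × X) (X × X) ℂ) (x, x₀) (x', x₀)) = 1 := by
      ext x x'
      obtain rfl := Subsingleton.elim x x'
      simp
    ext z z'
    change _ = (Φ - Ψ) (Matrix.of fun x x' => (1 : Matrix (X × X) (X × X) ℂ) (x, x₀) (x', x₀)) _ _
    rw [h1]
    rfl
  rw [hdia, dia, hset, csSup_singleton, hsub]
  exact div_le_div_of_nonneg_right
    (re_trace_mul_submatrix_le_traceNorm _ (fun z z' h => hg (Prod.ext_iff.1 h).1) hT) zero_le_two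

/-- The test operator `(2|w⟩⟨w| - 1) ⊕ κ`. -/
def reflectionTest {X : Type} [DecidableEq X] (w : X → ℂ) (κ : ℝ) :
    Matrix (X ⊕ Unit) (X ⊕ Unit) ℂ :=
  Matrix.fromBlocks ((2 : ℂ) • Matrix.vecMulVec w (star w) - 1) 0 0 (Matrix.of fun _ _ => (κ : ℂ))

theorem isContraction_reflectionTest {X : Type} [Fintype X] [DecidableEq X] {w : X → ℂ}
    (hw : star w ⬝ᵥ w = 1 ∨ w = 0) {κ : ℝ} (hκ : |κ| ≤ 1) :
    IsContraction (reflectionTest w κ) := by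
  intro v
  set R : Matrix X X ℂ := (2 : ℂ) • Matrix.vecMulVec w (star w) - 1 with hR
  -- `R` is Hermitian with square one: a reflection for a unit vector `w`, and `-1` for `w = 0`.
  have hRR : Rᴴ * R = 1 := by
    have h1 : Rᴴ = R := by
      simp [hR, Matrix.conjTranspose_sub, Matrix.conjTranspose_smul, Matrix.conjTranspose_vecMulVec]
    rw [h1, hR]
    rcases hw with hw | rfl
    · have h2 : Matrix.vecMulVec w (star w) * Matrix.vecMulVec w (star w) =
          Matrix.vecMulVec w (star w) := by
        rw [Matrix.vecMulVec_mul_vecMulVec, hw]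
        simp
      simp only [sub_mul, mul_sub, Matrix.smul_mul, Matrix.mul_smul, h2, mul_one, one_mul, smul_smul]
      module
    · simp
  have hiso : ∀ u : X → ℂ, ∑ x, ‖(R *ᵥ u) x‖ ^ 2 = ∑ x, ‖u x‖ ^ 2 := by
    intro u
    have key : ∀ u : X → ℂ, ((∑ x, ‖u x‖ ^ 2 : ℝ) : ℂ) = star u ⬝ᵥ u := by
      intro u
      rw [Complex.ofReal_sum]
      refine Finset.sum_congr rfl fun x _ => ?_
      rw [Pi.star_apply, mul_comm, Complex.star_def, Complex.mul_conj, Complex.normSq_eq_norm_sq]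
    apply Complex.ofReal_injective
    rw [key, key, Matrix.star_mulVec, ← Matrix.dotProduct_mulVec, Matrix.mulVec_mulVec, hRR,
      Matrix.one_mulVec]
  rw [reflectionTest, ← hR, Fintype.sum_sum_type, Fintype.sum_sum_type,
    ← hiso fun x => v (.inl x)]
  refine add_le_add (le_of_eq ?_) ?_
  · refine Finset.sum_congr rfl fun x _ => ?_
    simp [Matrix.mulVec, dotProduct]
  · refine Finset.sum_le_sum fun x _ => ?_
    simp only [Matrix.mulVec, dotProduct, Fintype.sum_sum_type, Matrix.fromBlocks_apply₂₁,
      Matrix.fromBlocks_apply₂₂, Matrix.zero_apply, zero_mul, Finset.sum_const_zero, zero_add,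
      Matrix.of_apply, Finset.univ_unique, Finset.sum_singleton, norm_mul, Complex.norm_real,
      Real.norm_eq_abs]
    exact pow_le_pow_left₀ (by positivity)
      (mul_le_of_le_one_left (norm_nonneg _) hκ) 2

theorem trace_reflectionTest_mul {X : Type} [Fintype X] [DecidableEq X] (w : X → ℂ) (κ : ℝ)
    (ρ : Matrix X X ℂ) (σ : Matrix Unit Unit ℂ) :
    (reflectionTest w κ * Matrix.fromBlocks ρ 0 0 σ).trace =
      2 * (star w ⬝ᵥ ρ *ᵥ w) - ρ.trace + κ * σ () () := by
  rw [reflectionTest, Matrix.fromBlocks_multiply]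
  simp only [Matrix.mul_zero, Matrix.zero_mul, add_zero, zero_add]
  have h : ∀ (P : Matrix X X ℂ) (Q : Matrix Unit Unit ℂ),
      (Matrix.fromBlocks P 0 0 Q).trace = P.trace + Q () () := by
    intro P Q
    simp [Matrix.trace, Fintype.sum_sum_type]
  rw [h, sub_mul, Matrix.trace_sub, one_mul, Matrix.smul_mul,
    Matrix.trace_smul, Matrix.trace_mul_comm (Matrix.vecMulVec _ _), Matrix.mul_vecMulVec,
    Matrix.trace_vecMulVec, dotProduct_comm, smul_eq_mul]
  simp [Matrix.mul_apply]

/-! ### Evaluation of attacks on the ideal resource -/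

theorem Super.tensor_apply {X Y Z W : Type} (Φ : Super X Y) (Ψ : Super Z W)
    (ρ : Matrix (X × Z) (X × Z) ℂ) (p q : Y × W) :
    Super.tensor Φ Ψ ρ p q =
      Φ (Matrix.of fun x x' => Ψ (Matrix.of fun z z' => ρ (x, z) (x', z')) p.2 q.2) p.1 q.1 := rfl

theorem Chan.relabel_map_apply_of {A B : QSys} (e : B ≃ A)
    (h : ∀ x x', B.blk x x' ↔ A.blk (e x) (e x')) (ρ : Matrix A A ℂ) {x x' : B}
    (hx : B.blk x x') : (Chan.relabel e h).map ρ x x' = ρ (e x) (e x') :=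
  QSys.pinch_apply_of hx _

/-- `Super.pi` is computed on matrix units, and within a block a relabelling sends each unit to an
indicator, so a single term of the double sum survives. -/
theorem Super.pi_relabel_apply {ι : Type} [Fintype ι] [DecidableEq ι] {A B : ι → QSys}
    (e : ∀ i, B i ≃ A i) (h : ∀ i x x', (B i).blk x x' ↔ (A i).blk (e i x) (e i x'))
    (ρ : Matrix (QSys.pi A) (QSys.pi A) ℂ) {y y' : QSys.pi B} (hy : (QSys.pi B).blk y y') :
    Super.pi (fun i => (Chan.relabel (e i) (h i)).map) ρ y y' =
      ρ (fun i => e i (y i)) fun i => e i (y' i) := by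
  have hy' : ∀ i, (B i).blk (y i) (y' i) := hy
  have key : ∀ x x' : (∀ i, A i), (∏ i, (Chan.relabel (e i) (h i)).map
      (Matrix.single (x i) (x' i) 1) (y i) (y' i)) =
      if x = (fun i => e i (y i)) ∧ x' = (fun i => e i (y' i)) then 1 else 0 := by
    intro x x'
    have h1 : ∀ i, (Chan.relabel (e i) (h i)).map (Matrix.single (x i) (x' i) 1) (y i) (y' i) =
        if x i = e i (y i) ∧ x' i = e i (y' i) then 1 else 0 := by
      intro i
      rw [Chan.relabel_map_apply_of _ _ _ (hy' i)]
      exact Matrix.single_apply ..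
    simp only [h1, Finset.prod_ite_zero, Finset.prod_const_one, Finset.mem_univ, forall_const,
      forall_and, funext_iff]
  change ∑ x, ∑ x', _ * ρ x x' = _
  simp only [key]
  rw [Finset.sum_eq_single (fun i => e i (y i)), Finset.sum_eq_single (fun i => e i (y' i))]
  · simp
  · intro x' _ hx'
    simp [hx']
  · simp
  · intro x _ hx
    simp [hx]
  · simp

theorem Super.pi_relabel_apply_not {ι : Type} [Fintype ι] [DecidableEq ι] {A B : ι → QSys}
    (e : ∀ i, B i ≃ A i) (h : ∀ i x x', (B i).blk x x' ↔ (A i).blk (e i x) (e i x'))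
    (ρ : Matrix (QSys.pi A) (QSys.pi A) ℂ) {y y' : QSys.pi B} (hy : ¬ (QSys.pi B).blk y y') :
    Super.pi (fun i => (Chan.relabel (e i) (h i)).map) ρ y y' = 0 := by
  obtain ⟨i, hi⟩ : ∃ i, ¬ (B i).blk (y i) (y' i) := not_forall.1 hy
  refine Finset.sum_eq_zero fun x _ => Finset.sum_eq_zero fun x' _ => ?_
  rw [Finset.prod_eq_zero (Finset.mem_univ i) (QSys.pinch_apply_not hi _), zero_mul]

theorem Chan.unitor_map_apply_of {A : QSys} (ρ : Matrix A A ℂ) {p q : A.tensor QSys.unit}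
    (h : A.blk p.1 q.1) : (Chan.unitor A).map ρ p q = ρ p.1 q.1 :=
  Chan.relabel_map_apply_of _ _ _ ⟨h, trivial⟩

theorem Chan.map_apply_unit {A : QSys} (f : Chan A QSys.unit) (ρ : Matrix A A ℂ) :
    f.map ρ () () = ρ.trace := by
  rw [← f.tp ρ]
  simp [Matrix.trace]

/-- The joint output of the clients, if they obtain the target state with weight `p` and the
abort signal with weight `q`. -/
def mixedOutput {K : ℕ} {n : Fin K → ℕ} (p q : ℂ) (ρ : Matrix (target n) (target n) ℂ) :
    Matrix (QSys.pi (clientOut n)) (QSys.pi (clientOut n)) ℂ :=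
  Super.push (outLabel n) (Matrix.fromBlocks (p • ρ) 0 0 (Matrix.of fun _ _ => q))

theorem mixedOutput_eq_distribute {K : ℕ} {n : Fin K → ℕ} (φ : State (target n)) (p q : ℂ) :
    mixedOutput p q φ.mat = p • (State.inl QSys.unit φ).distribute.mat +
      q • (State.inr (target n) State.one).distribute.mat := by
  change _ = p • Super.push (outLabel n) _ + q • Super.push (outLabel n) _
  rw [← map_smul, ← map_smul, ← map_add, mixedOutput]
  congr 1
  change _ = p • Matrix.fromBlocks φ.mat 0 0 0 + q • Matrix.fromBlocks 0 0 0 (1 : Matrix Unit Unit ℂ)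
  ext (x | x) (y | y) <;> simp

theorem ideal_chan_map_apply {K : ℕ} {n : Fin K → ℕ} (φ : State (target n))
    (ρ : Matrix (ideal φ).iface.dom (ideal φ).iface.dom ℂ) {y y' : QSys.pi (clientOut n)}
    (hy : (QSys.pi (clientOut n)).blk y y') :
    (ideal φ).chan.map ρ (y, ()) (y', ()) =
      ρ (fun _ => (), .inl ()) (fun _ => (), .inl ()) *
          (State.inl QSys.unit φ).distribute.mat y y' +
        ρ (fun _ => (), .inr ()) (fun _ => (), .inr ()) *
          (State.inr (target n) State.one).distribute.mat y y' := by
  refine (Chan.unitor_map_apply_of _ hy).trans ?_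
  refine congrArg₂ (· * (State.inl QSys.unit φ).distribute.mat y y' +
    · * (State.inr (target n) State.one).distribute.mat y y') ?_ ?_ <;>
  exact Chan.relabel_map_apply_of (A := (QSys.pi fun _ : Fin K => QSys.unit).tensor QSys.bit)
    (B := QSys.bit) ⟨fun b => (fun _ => (), b), Prod.snd, fun _ => rfl, fun _ => rfl⟩
    (fun _ _ => ⟨fun h => ⟨fun _ => trivial, h⟩, fun h => h.2⟩) _ (Setoid.refl' _ _)

/-- The clients' identity combs only relabel, and the source's last channel has trivial output, so
it traces out the memory. The simulator therefore enters only through the diagonal of its reduced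
state on the bit. -/
theorem eval_ideal_withSource {K : ℕ} {n : Fin K → ℕ} (φ : State (target n))
    (x : Comb [(QSys.bit, QSys.unit)] QSys.unit QSys.unit) :
    Protocol.eval (r := fun _ => ideal φ) ((Protocol.id (ideal φ).iface).withSource x) 1 =
      (mixedOutput (∑ m, x.first.map 1 (.inl (), m) (.inl (), m))
        (∑ m, x.first.map 1 (.inr (), m) (.inr (), m)) φ.mat).submatrix Prod.fst Prod.fst := by
  rcases x with _ | ⟨Y, g, _ | _⟩
  rename_i g'
  ext ⟨y, u⟩ ⟨y', u'⟩
  refine Eq.trans ?_ (congrFun (congrFun (mixedOutput_eq_distribute φ _ _).symm y) y')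
  set σ₀ := (State.inl QSys.unit φ).distribute
  set σ₁ := (State.inr (target n) State.one).distribute
  change Super.tensor (Super.pi fun i => (Chan.unitorInv (clientOut n i)).map) g'.map
    (Super.pull _ (Super.ampR ((Fin K → Unit) × Y) (ideal φ).chan.map (Super.pull _
      (Super.tensor (Super.pi fun _ => (Chan.unitor QSys.unit).map) g.map 1))))
      (y, ()) (y', ()) = (∑ m, g.map 1 (.inl (), m) (.inl (), m)) * σ₀.mat y y' +
        (∑ m, g.map 1 (.inr (), m) (.inr (), m)) * σ₁.mat y y'
  rw [Super.tensor_apply]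
  by_cases hy : (QSys.pi (clientOut n)).blk y y'
  · refine (Super.pi_relabel_apply _ _ _ hy).trans ?_
    rw [Matrix.of_apply, Chan.map_apply_unit, Matrix.trace, Fintype.sum_prod_type,
      Fintype.sum_unique, Finset.sum_mul, Finset.sum_mul, ← Finset.sum_add_distrib]
    refine Finset.sum_congr rfl fun m _ => ?_
    have hτ : ∀ b b' : QSys.bit, Super.tensor (Super.pi fun _ : Fin K =>
        (Chan.unitor QSys.unit).map) g.map 1 ((fun _ => ((), ())), (b, m)) ((fun _ => ((), ())), (b', m))
        = g.map 1 (b, m) (b', m) := by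
      intro b b'
      rw [Super.tensor_apply]
      refine (Super.pi_relabel_apply _ _ _ (Setoid.refl' _ _)).trans ?_
      rw [Matrix.of_apply]
      refine congrArg (fun M => g.map M (b, m) (b', m)) ?_
      ext z z'
      obtain rfl := Subsingleton.elim z z'
      simp
    refine (ideal_chan_map_apply φ _ hy).trans ?_
    exact congrArg₂ (· * σ₀.mat y y' + · * σ₁.mat y y') (hτ _ _) (hτ _ _)
  · refine (Super.pi_relabel_apply_not _ _ _ hy).trans ?_
    have h : ∀ σ : State (QSys.pi (clientOut n)), σ.mat y y' = 0 := fun σ => by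
      exact (congrFun (congrFun σ.blocks y) y').symm.trans (QSys.pinch_apply_not hy _)
    rw [h, h, mul_zero, mul_zero, add_zero]

theorem sum_bit_marginal {Y : QSys} (g : Chan QSys.unit (QSys.bit.tensor Y)) :
    ∑ m, g.map 1 (.inl (), m) (.inl (), m) + ∑ m, g.map 1 (.inr (), m) (.inr (), m) = 1 := by
  have h : (g.map 1).trace = 1 := by
    rw [g.tp]
    simp
  rw [← h, Matrix.trace, Fintype.sum_prod_type, Fintype.sum_sum_type]
  simp

/-- Only `p + q = 1` is recorded: the test used against the simulators takes the same value for all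
such weights. -/
theorem exists_eval_ideal_eq {K : ℕ} {n : Fin K → ℕ} (φ : State (target n))
    {B : Protocol (fun _ : Unit => (ideal φ).iface) (fun _ => QSys.unit) (clientOut n)
      QSys.unit QSys.unit}
    (hB : B ∈ (Protocol.id (ideal φ).iface).attacks QSys.unit QSys.unit) :
    ∃ p q : ℂ, p + q = 1 ∧ Protocol.eval (r := fun _ => ideal φ) B 1 =
      (mixedOutput p q φ.mat).submatrix Prod.fst Prod.fst := by
  obtain ⟨x, rfl⟩ := hB
  refine ⟨_, _, ?_, eval_ideal_withSource φ x⟩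
  exact sum_bit_marginal _

theorem eval_filter {K : ℕ} {n : Fin K → ℕ} (φ : State (target n)) :
    Protocol.eval (r := fun _ => ideal φ) (filter n) 1 =
      (mixedOutput 1 0 φ.mat).submatrix Prod.fst Prod.fst := by
  refine (eval_ideal_withSource φ _).trans ?_
  have h : ∀ b : QSys.bit, ∑ m : Unit, ((Chan.unitor QSys.bit).comp
      (Chan.prepare QSys.unit (State.inl QSys.unit State.one))).map 1 (b, m) (b, m) =
      (State.inl QSys.unit State.one).mat b b := by
    intro b
    rw [Fintype.sum_unique]
    refine (Chan.unitor_map_apply_of _ (Setoid.refl' _ _)).trans ?_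
    change Matrix.trace (1 : Matrix Unit Unit ℂ) * _ = _
    rw [Matrix.trace_one, Fintype.card_unit, Nat.cast_one, one_mul]
  congr 2
  · exact h _
  · exact h _

/-! ### The output of a simple protocol -/

/-- The `N`-fold tensor power of `ρ`. -/
def tensorPower {X : Type} (N : ℕ) (ρ : Matrix X X ℂ) : Matrix (Fin N → X) (Fin N → X) ℂ :=
  Matrix.of fun x y => ∏ k, ρ (x k) (y k)

theorem trace_tensorPower {X : Type} [Fintype X] [DecidableEq X] (N : ℕ) (ρ : Matrix X X ℂ) :
    (tensorPower N ρ).trace = ρ.trace ^ N := by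
  have h := Finset.prod_univ_sum (fun _ : Fin N => (Finset.univ : Finset X)) fun _ x => ρ x x
  rw [Fintype.piFinset_univ, Finset.prod_const, Finset.card_univ, Fintype.card_fin] at h
  exact h.symm

theorem moveBack_productState_const {N : ℕ} {A : QSys} (τ : State A) (r : Fin (N + 1)) :
    moveBack A r (productState fun _ => τ) = tensorPower N τ.mat ⊗ₖ τ.mat := by
  ext p q
  change ∏ k, τ.mat (Fin.insertNth (α := fun _ => (A : Type)) r p.2 p.1 k)
    (Fin.insertNth (α := fun _ => (A : Type)) r q.2 q.1 k) =
    (∏ k : Fin N, τ.mat (p.1 k) (q.1 k)) * τ.mat p.2 q.2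
  rw [Fin.prod_univ_succAbove _ r, mul_comm]
  simp

theorem Super.ampR_kronecker {X Y Z : Type} (Φ : Super X Y) (ρ : Matrix X X ℂ)
    (σ : Matrix Z Z ℂ) : Super.ampR Z Φ (ρ ⊗ₖ σ) = Φ ρ ⊗ₖ σ := by
  ext p q
  have h : (Matrix.of fun x x' => (ρ ⊗ₖ σ) (x, p.2) (x', q.2)) = σ p.2 q.2 • ρ := by
    ext x x'
    simp [mul_comm]
  change Φ (Matrix.of fun x x' => (ρ ⊗ₖ σ) (x, p.2) (x', q.2)) p.1 q.1 = Φ ρ p.1 q.1 * σ p.2 q.2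
  rw [h, map_smul, Matrix.smul_apply, smul_eq_mul, mul_comm]

/-- Moving any register to the end of a product of equal factors gives the same state, so the
average over `η` is trivial and the measured registers are independent of the output register. -/
theorem clientAlgorithm_productState_const {K N : ℕ} {n : Fin K → ℕ} {η : Fin (N + 1) → ℝ}
    (hη : ∑ r, η r = 1) (μ : Chan (QSys.pi fun _ : Fin N => target n) QSys.bit)
    (τ : State (target n)) :
    clientAlgorithm η μ (productState fun _ => τ) =
      mixedOutput (μ.map (tensorPower N τ.mat) (.inl ()) (.inl ()))
        (μ.map (tensorPower N τ.mat) (.inr ()) (.inr ())) τ.mat := by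
  have h1 : (∑ r, (η r : ℂ) • moveBack (target n) r) (productState fun _ => τ) =
      tensorPower N τ.mat ⊗ₖ τ.mat := by
    rw [LinearMap.sum_apply]
    refine (Finset.sum_congr rfl fun r _ => congrArg ((η r : ℂ) • ·)
      (moveBack_productState_const τ r)).trans ?_
    rw [← Finset.sum_smul, ← Complex.ofReal_sum, hη, Complex.ofReal_one, one_smul]
  rw [clientAlgorithm, LinearMap.comp_apply, LinearMap.comp_apply, LinearMap.comp_apply, h1,
    Super.ampR_kronecker, mixedOutput]
  congr 1
  ext (x | x) (y | y)
  · rfl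
  · rfl
  · rfl
  · change ∑ x, μ.map (tensorPower N τ.mat) (.inr ()) (.inr ()) * τ.mat x x =
      μ.map (tensorPower N τ.mat) (.inr ()) (.inr ())
    rw [← Finset.mul_sum]
    exact (congrArg (_ * ·) τ.density.2).trans (mul_one _)

/-- A client is needed to tell a share from the abort signal: for `K = 0` the two labels coincide.
-/
theorem outLabel_injective {K : ℕ} (hK : 0 < K) (n : Fin K → ℕ) :
    Function.Injective (outLabel n) := by
  rintro (x | x) (y | y) h
  · exact congrArg _ (funext fun i => Sum.inl_injective (congrFun h i))
  · cases congrFun h ⟨0, hK⟩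
  · cases congrFun h ⟨0, hK⟩
  · rfl

theorem push_submatrix {X Y : Type} [Fintype X] [DecidableEq Y] {f : X → Y}
    (hf : Function.Injective f) (ρ : Matrix X X ℂ) : (Super.push f ρ).submatrix f f = ρ := by
  classical
  ext x x'
  simp [Super.push, hf.eq_iff, ite_and]

/-- The advantage of the reflection test in distinguishing two joint outputs of the clients. -/
theorem reflectionTest_le_hdia {K : ℕ} (hK : 0 < K) {n : Fin K → ℕ}
    {Φ Ψ : Super ((QSys.pi fun _ : Fin K => QSys.unit).tensor QSys.unit)
      ((QSys.pi (clientOut n)).tensor QSys.unit)} {p q p' q' : ℂ} {τ φ : State (target n)}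
    (hΦ : Φ 1 = (mixedOutput p q τ.mat).submatrix Prod.fst Prod.fst)
    (hΨ : Ψ 1 = (mixedOutput p' q' φ.mat).submatrix Prod.fst Prod.fst)
    {w : target n → ℂ} (hw : star w ⬝ᵥ w = 1 ∨ w = 0) {κ : ℝ} (hκ : |κ| ≤ 1) :
    ((p * (2 * (star w ⬝ᵥ τ.mat *ᵥ w) - 1) + κ * q -
      (p' * (2 * (star w ⬝ᵥ φ.mat *ᵥ w) - 1) + κ * q')) : ℂ).re / 2 ≤ hdia Φ Ψ := by
  have hinj : Function.Injective
      fun z => ((outLabel n z, ()) : (QSys.pi (clientOut n)).tensor QSys.unit) :=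
    fun z z' h => outLabel_injective hK n (Prod.ext_iff.1 h).1
  refine le_trans (le_of_eq ?_) (re_trace_mul_submatrix_le_hdia (fun _ => (), ()) Φ Ψ hinj
    (isContraction_reflectionTest hw hκ))
  have h1 : ∀ (p q : ℂ) (ρ : State (target n)), (reflectionTest w κ *
      ((mixedOutput p q ρ.mat).submatrix Prod.fst Prod.fst).submatrix
        (fun z => ((outLabel n z, ()) : (QSys.pi (clientOut n)).tensor QSys.unit))
        fun z => ((outLabel n z, ()) : (QSys.pi (clientOut n)).tensor QSys.unit)).trace =
      p * (2 * (star w ⬝ᵥ ρ.mat *ᵥ w) - 1) + κ * q := by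
    intro p q ρ
    have h2 := push_submatrix (outLabel_injective hK n)
      (Matrix.fromBlocks (p • ρ.mat) 0 0 (Matrix.of fun _ _ => q))
    refine (congrArg (fun M => (reflectionTest w κ * M).trace) h2).trans ?_
    refine (trace_reflectionTest_mul w κ (p • ρ.mat) (Matrix.of fun _ _ => q)).trans ?_
    rw [Matrix.smul_mulVec, dotProduct_smul, Matrix.trace_smul, ρ.density.2, Matrix.of_apply,
      smul_eq_mul, smul_eq_mul]
    ring
  rw [hΦ, hΨ, Matrix.submatrix_sub, Pi.sub_apply, Pi.sub_apply, Matrix.mul_sub, Matrix.trace_sub]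
  exact congrArg (fun z : ℂ => z.re / 2) (congrArg₂ (· - ·) (h1 p q τ) (h1 p' q' φ)).symm

/-! ### Positivity of the measurement -/

theorem Chan.posSemidef_map {A B : QSys} (f : Chan A B) {ρ : Matrix A A ℂ} (hρ : ρ.PosSemidef) :
    (f.map ρ).PosSemidef :=
  (f.cp 1 _ (hρ.submatrix Prod.fst)).submatrix fun b => (b, 0)

/-- The probability that the measurement `μ` accepts `ρ`. -/
def acceptProb {A : QSys} (μ : Chan A QSys.bit) (ρ : Matrix A A ℂ) : ℝ :=
  (μ.map ρ (.inl ()) (.inl ())).re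

theorem acceptProb_nonneg {A : QSys} (μ : Chan A QSys.bit) {ρ : Matrix A A ℂ}
    (hρ : ρ.PosSemidef) : 0 ≤ acceptProb μ ρ :=
  (Complex.le_def.1 (μ.posSemidef_map hρ).diag_nonneg).1

theorem acceptProb_mono {A : QSys} (μ : Chan A QSys.bit) {ρ σ : Matrix A A ℂ}
    (h : (σ - ρ).PosSemidef) : acceptProb μ ρ ≤ acceptProb μ σ := by
  have h1 := acceptProb_nonneg μ h
  rw [acceptProb, map_sub, Matrix.sub_apply, Complex.sub_re] at h1
  exact sub_nonneg.1 h1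

theorem ofReal_acceptProb {A : QSys} (μ : Chan A QSys.bit) {ρ : Matrix A A ℂ}
    (hρ : ρ.PosSemidef) : (acceptProb μ ρ : ℂ) = μ.map ρ (.inl ()) (.inl ()) :=
  Complex.ext rfl (Complex.le_def.1 (μ.posSemidef_map hρ).diag_nonneg).2

theorem map_inr_eq {A : QSys} (μ : Chan A QSys.bit) {ρ : Matrix A A ℂ}
    (hρ : ρ.PosSemidef) : μ.map ρ (.inr ()) (.inr ()) = ρ.trace - acceptProb μ ρ := by
  rw [ofReal_acceptProb μ hρ, ← μ.tp ρ, Matrix.trace, Fintype.sum_sum_type]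
  simp

theorem acceptProb_le_trace {A : QSys} (μ : Chan A QSys.bit) {ρ : Matrix A A ℂ}
    (hρ : ρ.PosSemidef) : acceptProb μ ρ ≤ ρ.trace.re := by
  have h := (Complex.le_def.1 ((μ.posSemidef_map hρ).diag_nonneg (i := Sum.inr ()))).1
  rw [map_inr_eq μ hρ, Complex.sub_re, Complex.ofReal_re, Complex.zero_re] at h
  exact sub_nonneg.1 h

/-! ### Tensor powers and acceptance probabilities -/

/-- Each new factor is a Hadamard product with a pulled-back matrix, so the Schur product theorem
applies. The differences telescope: `τ ⊗ T - σ ⊗ S = τ ⊗ (T - S) + (τ - σ) ⊗ S`. Both claims are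
carried through the induction because the second uses the first. -/
theorem posSemidef_prod_and_sub {X : Type} [Fintype X] {N : ℕ} {σ τ : Matrix X X ℂ}
    (hσ : σ.PosSemidef) (h : (τ - σ).PosSemidef) (S : Finset (Fin N)) :
    (Matrix.of fun x y : Fin N → X => ∏ k ∈ S, σ (x k) (y k)).PosSemidef ∧
      ((Matrix.of fun x y : Fin N → X => ∏ k ∈ S, τ (x k) (y k)) -
        Matrix.of fun x y : Fin N → X => ∏ k ∈ S, σ (x k) (y k)).PosSemidef := by
  classical
  have hτ : τ.PosSemidef := by simpa using h.add hσ
  induction S using Finset.induction_on with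
  | empty =>
    constructor
    · have h1 := Matrix.posSemidef_vecMulVec_self_star (R := ℂ) (fun _ : Fin N → X => 1)
      convert h1 using 1
      ext x y
      simp [Matrix.vecMulVec_apply]
    · simpa using Matrix.PosSemidef.zero
  | insert k S hk ih =>
    obtain ⟨ih1, ih2⟩ := ih
    constructor
    · refine Eq.subst ?_ ((hσ.submatrix fun x : Fin N → X => x k).hadamard ih1)
      ext x y
      simp [hk]
    · refine Eq.subst ?_ (((hτ.submatrix fun x : Fin N → X => x k).hadamard ih2).add
        ((h.submatrix fun x : Fin N → X => x k).hadamard ih1))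
      ext x y
      simp only [hk, Matrix.sub_apply, Matrix.of_apply, Finset.prod_insert, not_false_eq_true,
        Matrix.add_apply, Matrix.hadamard_apply, Matrix.submatrix_apply]
      ring

theorem posSemidef_tensorPower {X : Type} [Fintype X] (N : ℕ) {σ : Matrix X X ℂ}
    (hσ : σ.PosSemidef) : (tensorPower N σ).PosSemidef :=
  (posSemidef_prod_and_sub (τ := σ) hσ (by simpa using Matrix.PosSemidef.zero) Finset.univ).1

theorem posSemidef_tensorPower_sub {X : Type} [Fintype X] (N : ℕ) {σ τ : Matrix X X ℂ}
    (hσ : σ.PosSemidef) (h : (τ - σ).PosSemidef) :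
    (tensorPower N τ - tensorPower N σ).PosSemidef :=
  (posSemidef_prod_and_sub hσ h Finset.univ).2

theorem tensorPower_smul {X : Type} (N : ℕ) (c : ℂ) (σ : Matrix X X ℂ) :
    tensorPower N (c • σ) = c ^ N • tensorPower N σ := by
  ext x y
  simp [tensorPower, Finset.prod_mul_distrib]

theorem acceptProb_smul {A : QSys} (μ : Chan A QSys.bit) (c : ℝ) (ρ : Matrix A A ℂ) :
    acceptProb μ ((c : ℂ) • ρ) = c * acceptProb μ ρ := by
  rw [acceptProb, map_smul, Matrix.smul_apply, smul_eq_mul, Complex.re_ofReal_mul, acceptProb]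

theorem acceptProb_add {A : QSys} (μ : Chan A QSys.bit) (ρ σ : Matrix A A ℂ) :
    acceptProb μ (ρ + σ) = acceptProb μ ρ + acceptProb μ σ := by
  rw [acceptProb, map_add, Matrix.add_apply, Complex.add_re, acceptProb, acceptProb]

theorem acceptProb_sub {A : QSys} (μ : Chan A QSys.bit) (ρ σ : Matrix A A ℂ) :
    acceptProb μ (ρ - σ) = acceptProb μ ρ - acceptProb μ σ := by
  rw [acceptProb, map_sub, Matrix.sub_apply, Complex.sub_re, acceptProb, acceptProb]

/-- The tensor power of a vector. -/
def vecPower {X : Type} (N : ℕ) (u : X → ℂ) : (Fin N → X) → ℂ := fun x => ∏ k, u (x k)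

theorem tensorPower_vecMulVec {X : Type} (N : ℕ) (u : X → ℂ) :
    tensorPower N (Matrix.vecMulVec u (star u)) =
      Matrix.vecMulVec (vecPower N u) (star (vecPower N u)) := by
  ext x y
  simp [tensorPower, vecPower, Matrix.vecMulVec_apply, Finset.prod_mul_distrib]

theorem star_vecPower_dotProduct {X : Type} [Fintype X] (N : ℕ) (u v : X → ℂ) :
    star (vecPower N u) ⬝ᵥ vecPower N v = (star u ⬝ᵥ v) ^ N := by
  classical
  have h := Finset.prod_univ_sum (fun _ : Fin N => (Finset.univ : Finset X))
    fun _ x => star (u x) * v x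
  rw [Fintype.piFinset_univ, Finset.prod_const, Finset.card_univ, Fintype.card_fin] at h
  refine Eq.trans ?_ h.symm
  refine Finset.sum_congr rfl fun x _ => ?_
  simp [vecPower, Finset.prod_mul_distrib]

/-- A Cauchy-Schwarz estimate with a free parameter: optimizing over `l` would give `2√(1 - C²)`,
and leaving `l` free avoids the root. -/
theorem acceptProb_vec_sub_le {A : QSys} (μ : Chan A QSys.bit) {u v : A → ℂ} {C : ℝ}
    (hu : star u ⬝ᵥ u = 1) (hv : star v ⬝ᵥ v = 1) (huv : star u ⬝ᵥ v = C) (l : ℝ) :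
    2 * l * (acceptProb μ (Matrix.vecMulVec v (star v)) -
      acceptProb μ (Matrix.vecMulVec u (star u))) ≤ l ^ 2 * (2 + 2 * C) + (2 - 2 * C) := by
  have hvu : star v ⬝ᵥ u = C := by
    rw [Matrix.star_dotProduct, huv]
    simp
  have hz := acceptProb_nonneg μ (Matrix.posSemidef_vecMulVec_self_star
    ((l : ℂ) • (u + v) - (v - u)))
  have hs := acceptProb_le_trace μ (Matrix.posSemidef_vecMulVec_self_star (u + v))
  have hd := acceptProb_le_trace μ (Matrix.posSemidef_vecMulVec_self_star (v - u))
  -- The cross terms of `u + v` and `v - u` add up to twice `|v⟩⟨v| - |u⟩⟨u|`, the difference to be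
  -- bounded.
  have h1 : Matrix.vecMulVec ((l : ℂ) • (u + v) - (v - u)) (star ((l : ℂ) • (u + v) - (v - u))) =
      ((l ^ 2 : ℝ) : ℂ) • Matrix.vecMulVec (u + v) (star (u + v)) +
        Matrix.vecMulVec (v - u) (star (v - u)) -
        ((2 * l : ℝ) : ℂ) • (Matrix.vecMulVec v (star v) - Matrix.vecMulVec u (star u)) := by
    ext x y
    simp [Matrix.vecMulVec_apply]
    ring
  rw [h1, acceptProb_sub, acceptProb_add, acceptProb_smul, acceptProb_smul, acceptProb_sub] at hz
  have h2 : (Matrix.vecMulVec (u + v) (star (u + v))).trace.re = 2 + 2 * C := by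
    rw [Matrix.trace_vecMulVec, dotProduct_comm, star_add, add_dotProduct, dotProduct_add,
      dotProduct_add, hu, hv, huv, hvu]
    simp
    ring
  have h3 : (Matrix.vecMulVec (v - u) (star (v - u))).trace.re = 2 - 2 * C := by
    rw [Matrix.trace_vecMulVec, dotProduct_comm, star_sub, sub_dotProduct, dotProduct_sub,
      dotProduct_sub, hu, hv, huv, hvu]
    simp
    ring
  nlinarith [mul_le_mul_of_nonneg_left hs (sq_nonneg l)]

/-! ### The attack with identical registers -/

/-- The source sends the state `τ` in every register; the attack is witnessed by the test vector `v`. -/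
theorem exists_attack_le_hdia_add_hdia {K N : ℕ} (hK : 0 < K) {n : Fin K → ℕ}
    {a e w w' : Fin K → QSys}
    {E : Chan (QSys.pi a) (QSys.pi e)} {W : Chan (QSys.pi w) (QSys.pi w')}
    {φ : State (target n)} {η : Fin (N + 1) → ℝ}
    {μ : Chan (QSys.pi fun _ : Fin N => target n) QSys.bit}
    {π : Protocol (fun j => (resources N (distribution n E) (coordination W) j).iface)
      (fun _ => QSys.unit) (clientOut n) QSys.unit QSys.unit}
    (hπ : IsSimple φ η μ π) (τ : State (target n)) {v : target n → ℂ} (hv : star v ⬝ᵥ v = 1)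
    {q r : ℝ} (hq : star v ⬝ᵥ φ.mat *ᵥ v = q) (hr : star v ⬝ᵥ τ.mat *ᵥ v = r)
    (hq0 : 0 ≤ q) (hq1 : q ≤ 1) :
    ∃ A ∈ π.attacks QSys.unit QSys.unit,
      ∀ B ∈ (Protocol.id (ideal φ).iface).attacks QSys.unit QSys.unit,
        1 - acceptProb μ (tensorPower N φ.mat) + acceptProb μ (tensorPower N τ.mat) * (r - q) ≤
          hdia π.eval (Protocol.eval (r := fun _ => ideal φ) (filter n)) +
          hdia A.eval (Protocol.eval (r := fun _ => ideal φ) B) := by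
  have hout : ∀ ρ : State (target n),
      (π.withSource (sendStates E W (fun _ => ρ) π.order QSys.unit)).eval 1 =
        (mixedOutput (acceptProb μ (tensorPower N ρ.mat))
          (1 - acceptProb μ (tensorPower N ρ.mat)) ρ.mat).submatrix Prod.fst Prod.fst := by
    intro ρ
    have hps := posSemidef_tensorPower N ρ.density.1
    rw [hπ.client, clientAlgorithm_productState_const hπ.prob.2, map_inr_eq μ hps,
      ← ofReal_acceptProb μ hps, trace_tensorPower, ρ.density.2, one_pow]
  refine ⟨_, ⟨sendStates E W (fun _ => τ) π.order QSys.unit, rfl⟩, fun B hB => ?_⟩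
  obtain ⟨p', q', hpq, hB'⟩ := exists_eval_ideal_eq φ hB
  have h1 := hout φ
  rw [← hπ.source] at h1
  change π.eval 1 = _ at h1
  -- The test `(-1) ⊕ 1` detects abort, which never occurs behind the filter; its advantage is `1 -
  -- p₀`.
  have h2 := reflectionTest_le_hdia hK h1 (eval_filter φ) (w := 0) (Or.inr rfl) (κ := 1) (by simp)
  -- On abort the test takes the value `2q - 1` that it has on `φ`, so `p'` cancels.
  have h3 := reflectionTest_le_hdia hK (hout τ) hB' (Or.inl hv) (κ := 2 * q - 1)
    (abs_le.2 ⟨by linarith, by linarith⟩)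
  have h4 : q' = 1 - p' := by rw [← hpq]; ring
  rw [hq, hr, h4] at h3
  refine le_trans (le_of_eq ?_) (add_le_add h2 h3)
  simp
  ring

/-! ### The deviating states -/

theorem target_pinch {K : ℕ} {n : Fin K → ℕ} (ρ : Matrix (target n) (target n) ℂ) :
    (target n).pinch ρ = ρ :=
  QSys.pinch_eq_self fun _ _ h => (h fun _ => trivial).elim

/-- The pure state of a unit vector. -/
def State.pure {K : ℕ} {n : Fin K → ℕ} (u : target n → ℂ) (hu : star u ⬝ᵥ u = 1) :
    State (target n) where
  mat := Matrix.vecMulVec u (star u)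
  density := ⟨Matrix.posSemidef_vecMulVec_self_star u, by
    rw [Matrix.trace_vecMulVec, dotProduct_comm, hu]⟩
  blocks := target_pinch _

/-- The mixture `(1 - s) φ + s σ`. -/
def State.mix {K : ℕ} {n : Fin K → ℕ} (φ σ : State (target n)) (s : ℝ) (h0 : 0 ≤ s)
    (h1 : s ≤ 1) : State (target n) where
  mat := ((1 - s : ℝ) : ℂ) • φ.mat + (s : ℂ) • σ.mat
  density := by
    refine ⟨(φ.density.1.smul ?_).add (σ.density.1.smul ?_), ?_⟩
    · exact Complex.zero_le_real.2 (sub_nonneg.2 h1)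
    · exact Complex.zero_le_real.2 h0
    · rw [Matrix.trace_add, Matrix.trace_smul, Matrix.trace_smul, φ.density.2, σ.density.2]
      simp
  blocks := target_pinch _

theorem acceptProb_tensorPower_mem {K N : ℕ} {n : Fin K → ℕ}
    (μ : Chan (QSys.pi fun _ : Fin N => target n) QSys.bit) (ρ : State (target n)) :
    acceptProb μ (tensorPower N ρ.mat) ∈ Set.Icc (0 : ℝ) 1 := by
  have hps := posSemidef_tensorPower N ρ.density.1
  refine ⟨acceptProb_nonneg μ hps, (acceptProb_le_trace μ hps).trans ?_⟩
  rw [trace_tensorPower, ρ.density.2, one_pow, Complex.one_re]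

/-- The mixture dominates `(1 - s) φ`, and both tensor powers and acceptance are monotone. -/
theorem acceptProb_tensorPower_mix {K N : ℕ} {n : Fin K → ℕ}
    (μ : Chan (QSys.pi fun _ : Fin N => target n) QSys.bit) (φ σ : State (target n)) {s : ℝ}
    (h0 : 0 ≤ s) (h1 : s ≤ 1) :
    (1 - s) ^ N * acceptProb μ (tensorPower N φ.mat) ≤
      acceptProb μ (tensorPower N (φ.mix σ s h0 h1).mat) := by
  have h2 := posSemidef_tensorPower_sub N (σ := ((1 - s : ℝ) : ℂ) • φ.mat)
    (τ := (φ.mix σ s h0 h1).mat)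
    (φ.density.1.smul (Complex.zero_le_real.2 (sub_nonneg.2 h1))) (by
      rw [State.mix, add_sub_cancel_left]
      exact σ.density.1.smul (Complex.zero_le_real.2 h0))
  have h3 := acceptProb_mono μ h2
  rw [tensorPower_smul, ← Complex.ofReal_pow] at h3
  exact (acceptProb_smul μ _ _).symm.trans_le h3

/-- Two diagonal entries of a density matrix sum to at most one, so the smaller is at most 1/2. -/
theorem State.exists_diag_le_half {K : ℕ} {n : Fin K → ℕ} [Nontrivial (∀ i, Fin (n i))]
    (φ : State (target n)) :
    ∃ (x : target n) (f : ℝ), φ.mat x x = f ∧ 0 ≤ f ∧ f ≤ 1 / 2 := by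
  have hreal : ∀ x, ((φ.mat x x).re : ℂ) = φ.mat x x := fun x =>
    Complex.ext rfl (Complex.le_def.1 φ.density.1.diag_nonneg).2
  have hnn : ∀ x, 0 ≤ (φ.mat x x).re := fun x => (Complex.le_def.1 φ.density.1.diag_nonneg).1
  have hsum : ∑ x, (φ.mat x x).re = 1 := by
    rw [← Complex.re_sum]
    exact congrArg Complex.re φ.density.2
  obtain ⟨x, y, hxy⟩ := exists_pair_ne (∀ i, Fin (n i))
  have hle : (φ.mat x x).re + (φ.mat y y).re ≤ 1 := by
    rw [← hsum, ← Finset.sum_pair (f := fun x => (φ.mat x x).re) hxy]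
    exact Finset.sum_le_sum_of_subset_of_nonneg (Finset.subset_univ _) fun x _ _ => hnn x
  rcases le_total (φ.mat x x).re (φ.mat y y).re with h | h
  · exact ⟨x, _, (hreal x).symm, hnn x, by linarith⟩
  · exact ⟨y, _, (hreal y).symm, hnn y, by linarith⟩

theorem exists_unit_orthogonal {X : Type} [Fintype X] [DecidableEq X] [Nontrivial X]
    {ψ : X → ℂ} (hψ : star ψ ⬝ᵥ ψ = 1) : ∃ u : X → ℂ, star u ⬝ᵥ u = 1 ∧ star ψ ⬝ᵥ u = 0 := by
  have hne : ψ ≠ 0 := by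
    rintro rfl
    simp at hψ
  obtain ⟨x, hx⟩ := Function.ne_iff.1 hne
  obtain ⟨y, hy⟩ := exists_ne x
  set c : ℝ := √(‖ψ x‖ ^ 2 + ‖ψ y‖ ^ 2) with hc
  have hpos : 0 < ‖ψ x‖ ^ 2 + ‖ψ y‖ ^ 2 := by
    have := norm_pos_iff.2 hx
    positivity
  have hc0 : (c : ℂ) ≠ 0 := Complex.ofReal_ne_zero.2 (Real.sqrt_pos.2 hpos).ne'
  have hc2 : (c : ℂ) * c = star (ψ x) * ψ x + star (ψ y) * ψ y := by
    rw [← Complex.ofReal_mul, hc, Real.mul_self_sqrt hpos.le, Complex.star_def,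
      mul_comm, Complex.mul_conj, mul_comm _ (ψ y), Complex.mul_conj, Complex.normSq_eq_norm_sq,
      Complex.normSq_eq_norm_sq, Complex.ofReal_add]
  -- In the plane of two coordinates, `(ψ̄_y, -ψ̄_x)` is orthogonal to `ψ`; it is nonzero because `ψ
  -- x ≠ 0`.
  refine ⟨(c : ℂ)⁻¹ • (Pi.single x (star (ψ y)) - Pi.single y (star (ψ x))), ?_, ?_⟩
  · rw [star_smul, smul_dotProduct, dotProduct_smul, star_sub, sub_dotProduct, Pi.star_single,
      Pi.star_single, single_dotProduct, single_dotProduct]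
    simp [hy, hy.symm]
    field_simp
    rw [pow_two, hc2, Complex.star_def]
    ring
  · rw [dotProduct_smul, dotProduct_sub, dotProduct_single, dotProduct_single]
    simp
    right
    ring

theorem dotProduct_vecMulVec_mulVec {X : Type} [Fintype X] {u v : X → ℂ} {c : ℝ}
    (h : star v ⬝ᵥ u = c) : star v ⬝ᵥ Matrix.vecMulVec u (star u) *ᵥ v = (c ^ 2 : ℝ) := by
  have h' : star u ⬝ᵥ v = c := by
    rw [Matrix.star_dotProduct, h]
    simp
  rw [Matrix.vecMulVec_mulVec, dotProduct_smul, h, h']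
  simp [pow_two]

/-- Vectors in the real plane spanned by an orthonormal pair. -/
theorem star_dotProduct_cos_sin {X : Type} [Fintype X] {ψ u : X → ℂ} (hψ : star ψ ⬝ᵥ ψ = 1)
    (hu : star u ⬝ᵥ u = 1) (hψu : star ψ ⬝ᵥ u = 0) (α θ : ℝ) :
    star ((Real.cos α : ℂ) • ψ + (Real.sin α : ℂ) • u) ⬝ᵥ
      ((Real.cos θ : ℂ) • ψ + (Real.sin θ : ℂ) • u) = (Real.cos (α - θ) : ℝ) := by
  have huψ : star u ⬝ᵥ ψ = 0 := by
    rw [Matrix.star_dotProduct, hψu]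
    simp
  rw [star_add, star_smul, star_smul, add_dotProduct, dotProduct_add, dotProduct_add]
  simp only [smul_dotProduct, dotProduct_smul, hψ, hu, hψu, huψ, Real.cos_sub]
  simp [← Complex.cos_conj, ← Complex.sin_conj]
  ring

theorem nontrivial_target {K : ℕ} {n : Fin K → ℕ} (hn : 2 ≤ ∏ i, n i) :
    Nontrivial (∀ i, Fin (n i)) := by
  rw [← Fintype.one_lt_card_iff_nontrivial, Fintype.card_pi]
  simpa [Nat.lt_iff_add_one_le] using hn

/-- Each register is replaced by a state with a small admixture of an unlikely basis vector. -/
theorem exists_mixing_attack {K N : ℕ} (hN : 1 ≤ N) {n : Fin K → ℕ} (hn : 2 ≤ ∏ i, n i)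
    {a e w w' : Fin K → QSys}
    {E : Chan (QSys.pi a) (QSys.pi e)} {W : Chan (QSys.pi w) (QSys.pi w')}
    {φ : State (target n)} {η : Fin (N + 1) → ℝ}
    {μ : Chan (QSys.pi fun _ : Fin N => target n) QSys.bit}
    {π : Protocol (fun j => (resources N (distribution n E) (coordination W) j).iface)
      (fun _ => QSys.unit) (clientOut n) QSys.unit QSys.unit}
    (hK : 0 < K) (hπ : IsSimple φ η μ π) :
    ∃ A ∈ π.attacks QSys.unit QSys.unit,
      ∀ B ∈ (Protocol.id (ideal φ).iface).attacks QSys.unit QSys.unit,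
        1 / (8 * (N : ℝ)) ≤
          hdia π.eval (Protocol.eval (r := fun _ => ideal φ) (filter n)) +
          hdia A.eval (Protocol.eval (r := fun _ => ideal φ) B) := by
  have := nontrivial_target hn
  obtain ⟨x, f, hf, hf0, hf1⟩ := φ.exists_diag_le_half
  have hNR : (1 : ℝ) ≤ N := by exact_mod_cast hN
  set v : target n → ℂ := Pi.single x 1 with hv
  have hvv : star v ⬝ᵥ v = 1 := by simp [hv]
  have hdiag : ∀ ρ : Matrix (target n) (target n) ℂ, star v ⬝ᵥ ρ *ᵥ v = ρ x x := by
    intro ρ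
    simp [hv, Pi.star_single]
  -- With `N s = 1/2`, Bernoulli's inequality leaves at least half of the acceptance probability.
  set s : ℝ := 1 / (2 * N) with hs
  have hs0 : 0 ≤ s := by positivity
  have hNs : N * s = 1 / 2 := by
    rw [hs]
    field_simp
  have hs1 : s ≤ 1 := by nlinarith
  set τ := φ.mix (State.pure v hvv) s hs0 hs1 with hτ
  have hτx : star v ⬝ᵥ τ.mat *ᵥ v = ((1 - s) * f + s : ℝ) := by
    rw [hdiag]
    change ((1 - s : ℝ) : ℂ) * φ.mat x x + s * (v x * star (v x)) = _
    rw [hf, hv, Pi.single_eq_same]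
    simp
  obtain ⟨A, hA, hAB⟩ := exists_attack_le_hdia_add_hdia hK hπ τ hvv ((hdiag _).trans hf) hτx hf0
    (by linarith)
  refine ⟨A, hA, fun B hB => le_trans ?_ (hAB B hB)⟩
  have hp := acceptProb_tensorPower_mix μ φ (State.pure v hvv) hs0 hs1
  rw [← hτ] at hp
  obtain ⟨h0, h1⟩ := acceptProb_tensorPower_mem μ φ
  set p₀ := acceptProb μ (tensorPower N φ.mat)
  have hpow : 1 / 2 ≤ (1 - s) ^ N := by
    have h := one_add_mul_le_pow (a := -s) (by linarith) N
    rw [← sub_eq_add_neg] at h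
    linarith
  have hp' : p₀ / 2 ≤ acceptProb μ (tensorPower N τ.mat) := by nlinarith
  have h8 : 1 / (8 * (N : ℝ)) = s / 4 := by
    rw [hs]
    field_simp
    norm_num
  have hsf : s / 2 ≤ (1 - s) * f + s - f := by nlinarith
  have h5 : p₀ / 2 * (s / 2) ≤ acceptProb μ (tensorPower N τ.mat) * ((1 - s) * f + s - f) :=
    mul_le_mul hp' hsf (by positivity) (le_trans (by positivity) hp')
  rw [h8]
  -- The bound is now `1 - p₀ + p₀ s / 4`, which is at least `s / 4` since `p₀ ≤ 1` and `s ≤ 4`.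
  nlinarith

/-- Each register is replaced by a slightly rotated pure state. -/
theorem exists_rotation_attack {K N : ℕ} (hN : 1 ≤ N) {n : Fin K → ℕ} (hn : 2 ≤ ∏ i, n i)
    {a e w w' : Fin K → QSys}
    {E : Chan (QSys.pi a) (QSys.pi e)} {W : Chan (QSys.pi w) (QSys.pi w')}
    {φ : State (target n)} {η : Fin (N + 1) → ℝ}
    {μ : Chan (QSys.pi fun _ : Fin N => target n) QSys.bit}
    {π : Protocol (fun j => (resources N (distribution n E) (coordination W) j).iface)
      (fun _ => QSys.unit) (clientOut n) QSys.unit QSys.unit}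
    (hK : 0 < K) (hπ : IsSimple φ η μ π) (hφ : φ.IsPure) :
    ∃ A ∈ π.attacks QSys.unit QSys.unit,
      ∀ B ∈ (Protocol.id (ideal φ).iface).attacks QSys.unit QSys.unit,
        1 / (8 * √(N : ℝ)) ≤
          hdia π.eval (Protocol.eval (r := fun _ => ideal φ) (filter n)) +
          hdia A.eval (Protocol.eval (r := fun _ => ideal φ) B) := by
  have : Nontrivial (target n) := nontrivial_target hn
  obtain ⟨ψ, hψ⟩ := hφ
  have hψψ : star ψ ⬝ᵥ ψ = 1 := by
    rw [← φ.density.2, hψ, Matrix.trace_vecMulVec, dotProduct_comm]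
  obtain ⟨u, hu, hψu⟩ := exists_unit_orthogonal hψψ
  have hNR : (1 : ℝ) ≤ N := by exact_mod_cast hN
  have hsq : 1 ≤ √(N : ℝ) := Real.one_le_sqrt.2 hNR
  -- `t` is the sine of the rotation angle; `N t² = 1/16` makes the squared overlap of the powers at
  -- least 15/16.
  set t : ℝ := 1 / (4 * √(N : ℝ)) with ht
  have ht0 : 0 ≤ t := by positivity
  have ht1 : t ≤ 1 := by
    rw [ht, div_le_one (by positivity)]
    linarith
  have hNt : N * t ^ 2 = 1 / 16 := by
    rw [ht, div_pow, mul_pow, Real.sq_sqrt (by positivity)]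
    field_simp
    norm_num
  set θ := Real.arcsin t with hθ
  have hsin : Real.sin θ = t := Real.sin_arcsin (by linarith) ht1
  have hcos : 0 ≤ Real.cos θ := Real.cos_arcsin_nonneg t
  -- The optimal test vector between angles `0` and `θ` lies at 45 degrees from their bisector; it
  -- gives `r - q = sin θ = t`.
  set α := θ / 2 + Real.pi / 4 with hα
  have key := star_dotProduct_cos_sin hψψ hu hψu
  set vec : ℝ → target n → ℂ := fun β => (Real.cos β : ℂ) • ψ + (Real.sin β : ℂ) • u with hvec
  have hvec0 : vec 0 = ψ := by simp [hvec]
  have hunit : ∀ β, star (vec β) ⬝ᵥ vec β = 1 := fun β => (key β β).trans (by simp)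
  set τ := State.pure (vec θ) (hunit θ) with hτ
  have hq : star (vec α) ⬝ᵥ φ.mat *ᵥ vec α = (Real.cos α ^ 2 : ℝ) := by
    rw [hψ]
    refine dotProduct_vecMulVec_mulVec ?_
    have h := key α 0
    rwa [sub_zero, show ((Real.cos 0 : ℝ) : ℂ) • ψ + ((Real.sin 0 : ℝ) : ℂ) • u = ψ from hvec0] at h
  have hr : star (vec α) ⬝ᵥ τ.mat *ᵥ vec α = (Real.cos (α - θ) ^ 2 : ℝ) :=
    dotProduct_vecMulVec_mulVec (key α θ)
  obtain ⟨A, hA, hAB⟩ := exists_attack_le_hdia_add_hdia hK hπ τ (hunit α) hq hr (sq_nonneg _)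
    (Real.cos_sq_le_one α)
  refine ⟨A, hA, fun B hB => le_trans ?_ (hAB B hB)⟩
  have hdiff : Real.cos (α - θ) ^ 2 - Real.cos α ^ 2 = t := by
    rw [Real.cos_sq, Real.cos_sq, show 2 * (α - θ) = Real.pi / 2 - θ by rw [hα]; ring,
      show 2 * α = θ + Real.pi / 2 by rw [hα]; ring, Real.cos_pi_div_two_sub,
      Real.cos_add_pi_div_two, hsin]
    ring
  rw [hdiff]
  set C : ℝ := Real.cos θ ^ N with hC
  have hC0 : 0 ≤ C := pow_nonneg hcos N
  have hC2 : 15 / 16 ≤ C ^ 2 := by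
    have h := one_add_mul_le_pow (a := -t ^ 2) (by nlinarith) N
    have h2 : Real.cos θ ^ 2 = 1 + -t ^ 2 := by rw [Real.cos_sq', hsin]; ring
    rw [← h2, ← pow_mul, mul_comm 2 N, pow_mul, ← hC] at h
    linarith
  have hUV : star (vecPower N (vec θ)) ⬝ᵥ vecPower N ψ = C := by
    have h := key θ 0
    rw [sub_zero, show ((Real.cos 0 : ℝ) : ℂ) • ψ + ((Real.sin 0 : ℝ) : ℂ) • u = ψ from hvec0] at h
    rw [star_vecPower_dotProduct]
    refine (congrArg (· ^ N) h).trans ?_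
    rw [hC, Complex.ofReal_pow]
  -- This `l` is optimal at `C² = 15/16`, where `√((1 - C)/(1 + C)) = 1/(4(1 + C))`. It yields `p₀ -
  -- p ≤ 1/4 + 4(1 - C²) ≤ 1/2`.
  have hle := acceptProb_vec_sub_le μ (u := vecPower N (vec θ)) (v := vecPower N ψ)
    (by rw [star_vecPower_dotProduct, hunit, one_pow])
    (by rw [star_vecPower_dotProduct, hψψ, one_pow]) hUV (1 / (4 * (1 + C)))
  rw [← tensorPower_vecMulVec, ← tensorPower_vecMulVec, ← hψ] at hle
  obtain ⟨h0, h1⟩ := acceptProb_tensorPower_mem μ φ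
  change 2 * (1 / (4 * (1 + C))) * (_ - acceptProb μ (tensorPower N τ.mat)) ≤ _ at hle
  set p₀ := acceptProb μ (tensorPower N φ.mat)
  set p := acceptProb μ (tensorPower N τ.mat)
  have hp : p₀ - p ≤ 1 / 2 := by
    have hD : 0 < 1 + C := by linarith
    have h2 : 2 * (1 + C) * (2 * (1 / (4 * (1 + C))) * (p₀ - p)) = p₀ - p := by
      field_simp
      ring
    have h3 : 2 * (1 + C) * ((1 / (4 * (1 + C))) ^ 2 * (2 + 2 * C) + (2 - 2 * C)) =
        1 / 4 + 4 * (1 - C ^ 2) := by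
      field_simp
      ring
    have h4 := mul_le_mul_of_nonneg_left hle (by linarith : 0 ≤ 2 * (1 + C))
    rw [h2, h3] at h4
    linarith
  have h8 : 1 / (8 * √(N : ℝ)) = t / 2 := by
    rw [ht]
    field_simp
    norm_num
  rw [h8]
  -- From `p ≥ p₀ - 1/2`, the bound is at least `(1 - p₀)(1 - t) + t/2 ≥ t/2`.
  nlinarith

end QSV
end

open QSV in
theorem theorem2 {K N : ℕ} (hN : 1 ≤ N) (n : Fin K → ℕ) (hn : 2 ≤ ∏ i, n i)
    {a e w w' : Fin K → QSys}
    (E : Chan (QSys.pi a) (QSys.pi e)) (W : Chan (QSys.pi w) (QSys.pi w'))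
    (φ : State (target n)) (η : Fin (N + 1) → ℝ)
    (μ : Chan (QSys.pi fun _ : Fin N => target n) QSys.bit)
    (π : Protocol (fun j => (resources N (distribution n E) (coordination W) j).iface)
      (fun _ => QSys.unit) (clientOut n) QSys.unit QSys.unit)
    (hπ : IsSimple φ η μ π) :
    (¬ φ.IsPure →
      ∃ (s t : QSys), ∃ A ∈ π.attacks s t, ∀ B ∈ (Protocol.id (ideal φ).iface).attacks s t,
        1 / (27 * (N : ℝ)) ≤
          hdia π.eval (Protocol.eval (r := fun _ => ideal φ) (filter n)) +
          hdia A.eval (Protocol.eval (r := fun _ => ideal φ) B)) ∧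
    (φ.IsPure →
      ∃ (s t : QSys), ∃ A ∈ π.attacks s t, ∀ B ∈ (Protocol.id (ideal φ).iface).attacks s t,
        1 / (8 * √(N : ℝ)) ≤
          hdia π.eval (Protocol.eval (r := fun _ => ideal φ) (filter n)) +
          hdia A.eval (Protocol.eval (r := fun _ => ideal φ) B)) := by
  -- Without clients the product of the dimensions is empty, hence 1.
  have hK : 0 < K := by
    rcases Nat.eq_zero_or_pos K with rfl | h
    · simp at hn
    · exact h
  refine ⟨fun _ => ⟨QSys.unit, QSys.unit, ?_⟩,
    fun hφ => ⟨QSys.unit, QSys.unit, exists_rotation_attack hN hn hK hπ hφ⟩⟩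
  obtain ⟨A, hA, h⟩ := exists_mixing_attack hN hn hK hπ
  refine ⟨A, hA, fun B hB => le_trans ?_ (h B hB)⟩
  have hNR : (1 : ℝ) ≤ N := by exact_mod_cast hN
  -- The mixing attack yields `1/(8N)`, which exceeds the required `1/(27N)`.
  exact one_div_le_one_div_of_le (by positivity) (by linarith)
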